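/- **Setting.** Let $C_{\mathbb Z}$ be one of the integral split composition rings: $\mathbb B_{\mathbb Z}=\{\mathrm{diag}(a,d):a,d\in\mathbb Z\}$; $\mathbb H_{\mathbb Z}=M_2(\mathbb Z)$ with norm $n=\det$, its matrix trace $t$ and conjugation $\overline{\begin{pmatrix}a&b\\c&d\end{pmatrix}}=\begin{pmatrix}d&-b\\-c&a\end{pmatrix}$ (restricted to $\mathbb B_{\mathbb Z}$); or $\mathbb O_{\mathbb Z}=\mathbb H_{\mathbb Z}\oplus\mathbb H_{\mathbb Z}v$ with $(a+bv)(c+dv)=(ac-\bar d b)+(da+b\bar c)v$, $n(a+bv)=\det a+\det b$, $t(a+bv)=t(a)$, $\overline{a+bv}=\bar a-bv$. Let $J_{\mathbb Z}=H_3(C_{\mathbb Z})$ be the module of Hermitian matrices $$A=\begin{pmatrix}a&z&\bar y\\ \bar z&b&x\\ y&\bar x&c\end{pmatrix},\qquad a,b,c\in\mathbb Z,\ x,y,z\in C_{\mathbb Z},$$ with cubic norm $N(A)=abc-a\,n(x)-b\,n(y)-c\,n(z)+t((xy)z)$, trace form $(A,A')=aa'+bb'+cc'+t(x\bar x')+t(y\bar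 y')+t(z\bar z')$, and adjoint $A^\#$, the Hermitian matrix with diagonal $bc-n(x),\,ac-n(y),\,ab-n(z)$ whose entries in the positions of $x,y,z$ are $\bar z\bar y-ax,\ \bar x\bar z-by,\ \bar y\bar x-cz$ (so that $3N(A,A,B)=(A^\#,B)$ for the symmetric trilinear form with $N(A,A,A)=N(A)$). Let $\mathcal M_{\mathbb Z}=\mathcal M(J_{\mathbb Z})=\mathbb Z\oplus\mathbb Z\oplus J_{\mathbb Z}\oplus J_{\mathbb Z}$. For $x=(\alpha,\beta,A,B)$ and $y=(\gamma,\delta,C,D)$ put $\{x,y\}=\alpha\delta-\beta\gamma+(A,D)-(B,C)$, $$q'(x)=-4(A^\#,B^\#)+4\alpha N(A)+4\beta N(B)+\bigl((A,B)-\alpha\beta\bigr)^2,\qquad q=-2q'.$$ Let $q(x,y,z,w)$ be the symmetric four-linear form with $q(x,x,x,x)=q(x)$ and define $T$ by $\{T(x,y,z),w\}=q(x,y,z,w)$ for all $w$; then $T(x,x,x)$ and $3T(x,x,y)$ lie in $\mathcal M_{\mathbb Z}$. Let $G_{\mathbb Z}$ be the group of invertible $\mathbb Z$-linear maps of $\mathcal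 M_{\mathbb Z}$ preserving $\{\cdot,\cdot\}$ and $q$; elements in one $G_{\mathbb Z}$-orbit are called equivalent. The rank of $x$ is $4$ iff $q(x)\ne0$; it is $\le3$ iff $q(x)=0$; $\le2$ iff $T(x,x,x)=0$; $\le1$ iff $3T(x,x,y)+\{x,y\}x=0$ for all $y$; and $0$ iff $x=0$. Let $d_1(x)$ be the greatest integer dividing $x$, and $d_2(x)$ the greatest integer dividing all elements $3T(x,x,y)+\{x,y\}x$, $y\in\mathcal M_{\mathbb Z}$. An element is projective if it is equivalent to some $(\alpha,\beta,\mathrm{diag}(a_1,a_2,a_3),0)$ with $\alpha>0$, $\alpha\mid\beta$, $\alpha\mid a_i$ and $\gcd(\alpha a_1,\alpha\beta,a_2a_3)=\gcd(\alpha a_2,\alpha\beta,a_1a_3)=\gcd(\alpha a_3,\alpha\beta,a_1a_2)=1$. **Theorem.** (1) Every $x\in\mathcal M_{\mathbb Z}$ of rank $1$ is equivalent to $(\alpha,0,0,0)$ with $\alpha=d_1(x)\ge 1$. The elements $(k,0,0,0)$, $k\in\mathbb Z$, $k\ge1$, form a complete set of distinct orbit representatives of the elements of rank $1$. (2) Every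 $x\in\mathcal M_{\mathbb Z}$ of rank $2$ is equivalent to $(\alpha,0,\mathrm{diag}(a,0,0),0)$ with $\alpha=d_1(x)>0$, $a=d_2(x)/(2\alpha)>0$ and $\alpha\mid a$. The elements $(k,0,\mathrm{diag}(m,0,0),0)$ with $k,m\in\mathbb Z$, $k,m>0$, $k\mid m$ form a complete set of distinct orbit representatives of the elements of rank $2$. (3) Any two projective elements of rank $3$ or $4$ with the same value of $q'$ are equivalent. Every projective element $x$ of rank $3$ or $4$ is equivalent to an element $(1,\varepsilon,\mathrm{diag}(1,1,k),0)$ with $\varepsilon\in\{0,1\}$, $k\in\mathbb Z$; here $\varepsilon$ and $k$ are uniquely determined by $x$, namely $\varepsilon\equiv q'(x)\pmod 2$ and $k=(q'(x)-\varepsilon^2)/4$. -/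

import Mathlib

/-! ### Split composition rings over the integers -/

/-- A composition ring over `ℤ`: a unital, not necessarily associative ring with a conjugation,
an integral trace and an integral quadratic norm that permits composition and whose polar form
`trace (x * conj y)` is nondegenerate. -/
class CompositionRing (C : Type) extends NonAssocRing C where
  conj : C →+ C
  trace : C →+ ℤ
  nrm : C → ℤ
  conj_conj : ∀ x, conj (conj x) = x
  conj_mul_rev : ∀ x y, conj (x * y) = conj y * conj x
  add_conj : ∀ x, x + conj x = trace x • (1 : C)
  mul_conj : ∀ x, x * conj x = nrm x • (1 : C)
  nrm_mul : ∀ x y, nrm (x * y) = nrm x * nrm y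
  nrm_add : ∀ x y, nrm (x + y) = nrm x + trace (x * conj y) + nrm y
  trace_one : trace 1 = 2
  trace_conj : ∀ x, trace (conj x) = trace x
  trace_mul_comm : ∀ x y, trace (x * y) = trace (y * x)
  trace_mul_assoc : ∀ x y z, trace ((x * y) * z) = trace (x * (y * z))
  trace_nondegenerate : ∀ x, (∀ y, trace (x * conj y) = 0) → x = 0

/-- Integral split binarions: the pair `(a, d)` stands for the diagonal matrix with
entries `a`, `d`; so the product is componentwise. -/
abbrev Binarions : Type := ℤ × ℤ

/-- Integral split quaternions: integral `2 × 2` matrices. -/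
abbrev Quaternions : Type := Matrix (Fin 2) (Fin 2) ℤ

/-- Integral split octonions `a + b v`, with `a`, `b` integral split quaternions. -/
@[ext]
structure Octonions : Type where
  a : Quaternions
  b : Quaternions

instance instCompositionRingBinarions : CompositionRing Binarions where
  conj :=
    { toFun := fun x => (x.2, x.1)
      map_zero' := rfl
      map_add' := fun _ _ => rfl }
  trace :=
    { toFun := fun x => x.1 + x.2
      map_zero' := rfl
      map_add' := fun x y => by simp only [Prod.fst_add, Prod.snd_add]; ring }
  nrm := fun x => x.1 * x.2
  conj_conj := fun _ => rfl
  conj_mul_rev := fun x y => by ext <;> simp [mul_comm]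
  add_conj := fun x => by ext <;> simp [add_comm]
  mul_conj := fun x => by ext <;> simp [mul_comm]
  nrm_mul := fun x y => by simp; ring
  nrm_add := fun x y => by simp; ring
  trace_one := by simp
  trace_conj := fun x => by simp [add_comm]
  trace_mul_comm := fun x y => by simp [mul_comm]
  trace_mul_assoc := fun x y z => by simp [mul_assoc]
  trace_nondegenerate := fun x h => by
    have h1 := h (1, 0)
    have h2 := h (0, 1)
    ext <;> simp_all

/-- The symplectic involution of a `2 × 2` matrix, as an additive map. -/
def quatConj : Quaternions →+ Quaternions where
  toFun := fun x => !![x 1 1, -x 0 1; -x 1 0, x 0 0]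
  map_zero' := by ext i j; fin_cases i <;> fin_cases j <;> simp
  map_add' := fun x y => by ext i j; fin_cases i <;> fin_cases j <;> simp [add_comm]

@[simp] theorem quatConj_00 (x : Quaternions) : quatConj x 0 0 = x 1 1 := rfl
@[simp] theorem quatConj_01 (x : Quaternions) : quatConj x 0 1 = -x 0 1 := rfl
@[simp] theorem quatConj_10 (x : Quaternions) : quatConj x 1 0 = -x 1 0 := rfl
@[simp] theorem quatConj_11 (x : Quaternions) : quatConj x 1 1 = x 0 0 := rfl

instance instCompositionRingQuaternions : CompositionRing Quaternions where
  conj := quatConj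
  trace :=
    { toFun := fun x => x 0 0 + x 1 1
      map_zero' := by simp
      map_add' := fun x y => by simp only [Matrix.add_apply]; ring }
  nrm := fun x => x 0 0 * x 1 1 - x 0 1 * x 1 0
  conj_conj := fun x => by
    ext i j; fin_cases i <;> fin_cases j <;> simp
  conj_mul_rev := fun x y => by
    ext i j; fin_cases i <;> fin_cases j <;>
      simp [Matrix.mul_apply, Fin.sum_univ_two] <;> ring
  add_conj := fun x => by
    ext i j; fin_cases i <;> fin_cases j <;> simp [add_comm]
  mul_conj := fun x => by
    ext i j; fin_cases i <;> fin_cases j <;>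
      simp [Matrix.mul_apply, Fin.sum_univ_two] <;> ring
  nrm_mul := fun x y => by simp [Matrix.mul_apply, Fin.sum_univ_two]; ring
  nrm_add := fun x y => by simp [Matrix.mul_apply, Fin.sum_univ_two]; ring
  trace_one := by simp
  trace_conj := fun x => by simp [add_comm]
  trace_mul_comm := fun x y => by simp [Matrix.mul_apply, Fin.sum_univ_two]; ring
  trace_mul_assoc := fun x y z => by simp [Matrix.mul_apply, Fin.sum_univ_two]; ring
  trace_nondegenerate := fun x h => by
    have h1 := h !![1, 0; 0, 0]
    have h2 := h !![0, 1; 0, 0]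
    have h3 := h !![0, 0; 1, 0]
    have h4 := h !![0, 0; 0, 1]
    ext i j; fin_cases i <;> fin_cases j <;>
      simp_all [Matrix.mul_apply, Fin.sum_univ_two]

namespace Octonions

instance : Zero Octonions := ⟨⟨0, 0⟩⟩
instance : One Octonions := ⟨⟨1, 0⟩⟩
instance : Add Octonions := ⟨fun x y => ⟨x.a + y.a, x.b + y.b⟩⟩
instance : Neg Octonions := ⟨fun x => ⟨-x.a, -x.b⟩⟩
instance : Sub Octonions := ⟨fun x y => ⟨x.a - y.a, x.b - y.b⟩⟩
instance : SMul ℕ Octonions := ⟨fun n x => ⟨n • x.a, n • x.b⟩⟩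
instance : SMul ℤ Octonions := ⟨fun n x => ⟨n • x.a, n • x.b⟩⟩

/-- The Cayley-Dickson product `(a + b v)(c + d v) = (a c - d̄ b) + (d a + b c̄) v`. -/
instance : Mul Octonions :=
  ⟨fun x y => ⟨x.a * y.a - quatConj y.b * x.b, y.b * x.a + x.b * quatConj y.a⟩⟩

@[simp] theorem zero_a : (0 : Octonions).a = 0 := rfl
@[simp] theorem zero_b : (0 : Octonions).b = 0 := rfl
@[simp] theorem one_a : (1 : Octonions).a = 1 := rfl
@[simp] theorem one_b : (1 : Octonions).b = 0 := rfl
@[simp] theorem add_a (x y : Octonions) : (x + y).a = x.a + y.a := rfl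
@[simp] theorem add_b (x y : Octonions) : (x + y).b = x.b + y.b := rfl
@[simp] theorem neg_a (x : Octonions) : (-x).a = -x.a := rfl
@[simp] theorem neg_b (x : Octonions) : (-x).b = -x.b := rfl
@[simp] theorem sub_a (x y : Octonions) : (x - y).a = x.a - y.a := rfl
@[simp] theorem sub_b (x y : Octonions) : (x - y).b = x.b - y.b := rfl
@[simp] theorem nsmul_a (n : ℕ) (x : Octonions) : (n • x).a = n • x.a := rfl
@[simp] theorem nsmul_b (n : ℕ) (x : Octonions) : (n • x).b = n • x.b := rfl
@[simp] theorem zsmul_a (n : ℤ) (x : Octonions) : (n • x).a = n • x.a := rfl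
@[simp] theorem zsmul_b (n : ℤ) (x : Octonions) : (n • x).b = n • x.b := rfl
@[simp] theorem mul_a (x y : Octonions) :
    (x * y).a = x.a * y.a - quatConj y.b * x.b := rfl
@[simp] theorem mul_b (x y : Octonions) :
    (x * y).b = y.b * x.a + x.b * quatConj y.a := rfl

theorem toPair_injective :
    Function.Injective (fun x : Octonions => ((x.a, x.b) : Quaternions × Quaternions)) := by
  intro x y h
  exact Octonions.ext (congrArg Prod.fst h) (congrArg Prod.snd h)

instance : AddCommGroup Octonions :=
  toPair_injective.addCommGroup _ rfl (fun _ _ => rfl) (fun _ => rfl) (fun _ _ => rfl)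
    (fun _ _ => rfl) (fun _ _ => rfl)

instance : NonAssocRing Octonions where
  left_distrib := fun x y z => by
    ext1
    · simp only [mul_a, add_a, add_b, map_add, mul_add, add_mul]; abel
    · simp only [mul_b, add_a, add_b, map_add, mul_add, add_mul]; abel
  right_distrib := fun x y z => by
    ext1
    · simp only [mul_a, add_a, add_b, mul_add, add_mul]; abel
    · simp only [mul_b, add_a, add_b, mul_add, add_mul]; abel
  zero_mul := fun x => by ext1 <;> simp
  mul_zero := fun x => by ext1 <;> simp
  one_mul := fun x => by ext1 <;> simp
  mul_one := fun x => by
    ext i j <;> fin_cases i <;> fin_cases j <;>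
      simp [Matrix.mul_apply, Fin.sum_univ_two]

end Octonions

instance instCompositionRingOctonions : CompositionRing Octonions where
  conj :=
    { toFun := fun x => ⟨quatConj x.a, -x.b⟩
      map_zero' := by ext1 <;> simp
      map_add' := fun x y => by
        ext1
        · simp
        · simp only [Octonions.add_b, neg_add] }
  trace :=
    { toFun := fun x => CompositionRing.trace x.a
      map_zero' := by simp
      map_add' := fun x y => by simp }
  nrm := fun x => CompositionRing.nrm x.a + CompositionRing.nrm x.b
  conj_conj := fun x => by
    ext i j <;> fin_cases i <;> fin_cases j <;> simp
  conj_mul_rev := fun x y => by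
    ext i j <;> fin_cases i <;> fin_cases j <;>
      simp [Matrix.mul_apply, Fin.sum_univ_two] <;> ring
  add_conj := fun x => by
    ext i j <;> fin_cases i <;> fin_cases j <;>
      simp [-zsmul_eq_mul, -zsmul_one, CompositionRing.trace, add_comm]
  mul_conj := fun x => by
    ext i j <;> fin_cases i <;> fin_cases j <;>
      simp [-zsmul_eq_mul, -zsmul_one, CompositionRing.nrm, Matrix.mul_apply, Fin.sum_univ_two] <;> ring
  nrm_mul := fun x y => by
    simp [CompositionRing.nrm, Matrix.mul_apply, Fin.sum_univ_two]; ring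
  nrm_add := fun x y => by
    simp [CompositionRing.nrm, CompositionRing.trace, Matrix.mul_apply,
      Fin.sum_univ_two]; ring
  trace_one := by simp [CompositionRing.trace]
  trace_conj := fun x => by simp [CompositionRing.trace, add_comm]
  trace_mul_comm := fun x y => by
    simp [CompositionRing.trace, Matrix.mul_apply, Fin.sum_univ_two]; ring
  trace_mul_assoc := fun x y z => by
    simp [CompositionRing.trace, Matrix.mul_apply, Fin.sum_univ_two]; ring
  trace_nondegenerate := fun x h => by
    have h1 := h ⟨!![1, 0; 0, 0], 0⟩
    have h2 := h ⟨!![0, 1; 0, 0], 0⟩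
    have h3 := h ⟨!![0, 0; 1, 0], 0⟩
    have h4 := h ⟨!![0, 0; 0, 1], 0⟩
    have h5 := h ⟨0, !![1, 0; 0, 0]⟩
    have h6 := h ⟨0, !![0, 1; 0, 0]⟩
    have h7 := h ⟨0, !![0, 0; 1, 0]⟩
    have h8 := h ⟨0, !![0, 0; 0, 1]⟩
    ext i j <;> fin_cases i <;> fin_cases j <;>
      simp_all [CompositionRing.trace, Matrix.mul_apply, Fin.sum_univ_two]

/-- The three cases: binarions, quaternions, octonions. -/
inductive SplitKind : Type
  | binarions
  | quaternions
  | octonions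

/-- The integral split composition ring of the given kind. -/
def SplitRing : SplitKind → Type
  | SplitKind.binarions => Binarions
  | SplitKind.quaternions => Quaternions
  | SplitKind.octonions => Octonions

instance instCompositionRingSplitRing : (κ : SplitKind) → CompositionRing (SplitRing κ)
  | SplitKind.binarions => instCompositionRingBinarions
  | SplitKind.quaternions => instCompositionRingQuaternions
  | SplitKind.octonions => instCompositionRingOctonions

/-! ### Hermitian matrices of size three -/

/-- The Hermitian matrix with rows `(a, z, ȳ)`, `(z̄, b, x)`, `(y, x̄, c)`. -/
@[ext]
structure Herm3 (C : Type) : Type where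
  a : ℤ
  b : ℤ
  c : ℤ
  x : C
  y : C
  z : C

namespace Herm3

theorem toTuple_injective {C : Type} :
    Function.Injective (fun A : Herm3 C => (A.a, A.b, A.c, A.x, A.y, A.z)) := by
  rintro ⟨_, _, _, _, _, _⟩ ⟨_, _, _, _, _, _⟩ h
  simpa using h

open CompositionRing

variable {C : Type} [CompositionRing C]

instance : Zero (Herm3 C) := ⟨⟨0, 0, 0, 0, 0, 0⟩⟩
instance : Add (Herm3 C) :=
  ⟨fun A B => ⟨A.a + B.a, A.b + B.b, A.c + B.c, A.x + B.x, A.y + B.y, A.z + B.z⟩⟩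
instance : Neg (Herm3 C) := ⟨fun A => ⟨-A.a, -A.b, -A.c, -A.x, -A.y, -A.z⟩⟩
instance : Sub (Herm3 C) :=
  ⟨fun A B => ⟨A.a - B.a, A.b - B.b, A.c - B.c, A.x - B.x, A.y - B.y, A.z - B.z⟩⟩
instance : SMul ℕ (Herm3 C) :=
  ⟨fun n A => ⟨n • A.a, n • A.b, n • A.c, n • A.x, n • A.y, n • A.z⟩⟩
instance : SMul ℤ (Herm3 C) :=
  ⟨fun n A => ⟨n • A.a, n • A.b, n • A.c, n • A.x, n • A.y, n • A.z⟩⟩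

instance : AddCommGroup (Herm3 C) :=
  toTuple_injective.addCommGroup _ rfl (fun _ _ => rfl) (fun _ => rfl) (fun _ _ => rfl)
    (fun _ _ => rfl) (fun _ _ => rfl)

/-- The diagonal matrix with the given diagonal entries. -/
def diag (a b c : ℤ) : Herm3 C := ⟨a, b, c, 0, 0, 0⟩

/-- The cubic form
`abc - a x x̄ - b y ȳ - c z z̄ + ((xy)z + z̄(ȳx̄))`; the last two summands are conjugate, so
their sum is the trace of `(xy)z`. -/
def det (A : Herm3 C) : ℤ :=
  A.a * A.b * A.c - A.a * nrm A.x - A.b * nrm A.y - A.c * nrm A.z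
    + trace ((A.x * A.y) * A.z)

/-- The trace bilinear form, that is the trace of `(AB + BA) / 2`. -/
def bil (A B : Herm3 C) : ℤ :=
  A.a * B.a + A.b * B.b + A.c * B.c
    + trace (A.x * conj B.x) + trace (A.y * conj B.y) + trace (A.z * conj B.z)

/-- The adjoint matrix `A^#`. -/
def sharp (A : Herm3 C) : Herm3 C :=
  ⟨A.b * A.c - nrm A.x, A.a * A.c - nrm A.y, A.a * A.b - nrm A.z,
    conj A.z * conj A.y - A.a • A.x,
    conj A.x * conj A.z - A.b • A.y,
    conj A.y * conj A.x - A.c • A.z⟩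

/-- The linearization `A × B` of the adjoint. -/
def cross (A B : Herm3 C) : Herm3 C := sharp (A + B) - sharp A - sharp B

@[simp] theorem add_a' (A B : Herm3 C) : (A + B).a = A.a + B.a := rfl
@[simp] theorem add_b' (A B : Herm3 C) : (A + B).b = A.b + B.b := rfl
@[simp] theorem add_c' (A B : Herm3 C) : (A + B).c = A.c + B.c := rfl
@[simp] theorem add_x' (A B : Herm3 C) : (A + B).x = A.x + B.x := rfl
@[simp] theorem add_y' (A B : Herm3 C) : (A + B).y = A.y + B.y := rfl
@[simp] theorem add_z' (A B : Herm3 C) : (A + B).z = A.z + B.z := rfl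
@[simp] theorem sub_a' (A B : Herm3 C) : (A - B).a = A.a - B.a := rfl
@[simp] theorem sub_b' (A B : Herm3 C) : (A - B).b = A.b - B.b := rfl
@[simp] theorem sub_c' (A B : Herm3 C) : (A - B).c = A.c - B.c := rfl
@[simp] theorem sub_x' (A B : Herm3 C) : (A - B).x = A.x - B.x := rfl
@[simp] theorem sub_y' (A B : Herm3 C) : (A - B).y = A.y - B.y := rfl
@[simp] theorem sub_z' (A B : Herm3 C) : (A - B).z = A.z - B.z := rfl
@[simp] theorem smul_a' (n : ℤ) (A : Herm3 C) : (n • A).a = n * A.a := rfl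
@[simp] theorem smul_b' (n : ℤ) (A : Herm3 C) : (n • A).b = n * A.b := rfl
@[simp] theorem smul_c' (n : ℤ) (A : Herm3 C) : (n • A).c = n * A.c := rfl
@[simp] theorem smul_x' (n : ℤ) (A : Herm3 C) : (n • A).x = n • A.x := rfl
@[simp] theorem smul_y' (n : ℤ) (A : Herm3 C) : (n • A).y = n • A.y := rfl
@[simp] theorem smul_z' (n : ℤ) (A : Herm3 C) : (n • A).z = n • A.z := rfl

theorem bil_symm (A B : Herm3 C) : bil A B = bil B A := by
  have h : ∀ u v : C, trace (u * conj v) = trace (v * conj u) := fun u v => by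
    rw [← trace_conj (u * conj v), conj_mul_rev, conj_conj]
  simp only [bil, h A.x, h A.y, h A.z]
  ring

theorem bil_add (A B D : Herm3 C) : bil A (B + D) = bil A B + bil A D := by
  simp only [bil, add_a', add_b', add_c', add_x', add_y', add_z', map_add, mul_add]
  ring

theorem bil_smul (n : ℤ) (A B : Herm3 C) : bil A (n • B) = n * bil A B := by
  simp only [bil, smul_a', smul_b', smul_c', smul_x', smul_y', smul_z', map_zsmul,
    mul_smul_comm, smul_eq_mul]
  ring

theorem nrm_smul (n : ℤ) (u : C) : nrm (n • u) = n ^ 2 * nrm u := by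
  have h : ∀ v : C, 2 * nrm v = trace (v * conj v) := fun v => by
    rw [mul_conj, map_zsmul, trace_one, smul_eq_mul, mul_comm]
  have h1 := h (n • u)
  simp only [map_zsmul, smul_mul_assoc, mul_smul_comm, ← h u, smul_eq_mul] at h1
  nlinarith

theorem sharp_smul (n : ℤ) (A : Herm3 C) : sharp (n • A) = n ^ 2 • sharp A := by
  ext1 <;>
    simp only [sharp, smul_a', smul_b', smul_c', smul_x', smul_y', smul_z', nrm_smul, map_zsmul,
      smul_mul_assoc, mul_smul_comm]
  · ring
  · ring
  · ring
  all_goals module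

theorem det_smul (n : ℤ) (A : Herm3 C) : det (n • A) = n ^ 3 * det A := by
  simp only [det, smul_a', smul_b', smul_c', smul_x', smul_y', smul_z', nrm_smul, map_zsmul,
    smul_mul_assoc, mul_smul_comm, smul_eq_mul]
  ring

theorem sharp_add (A B : Herm3 C) : sharp (A + B) = sharp A + cross A B + sharp B := by
  rw [cross]; abel

theorem cross_comm (A B : Herm3 C) : cross A B = cross B A := by
  rw [cross, cross, add_comm A B]; abel

theorem cross_eq (A B : Herm3 C) : cross A B =
    ⟨A.b * B.c + B.b * A.c - trace (A.x * conj B.x),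
      A.a * B.c + B.a * A.c - trace (A.y * conj B.y),
      A.a * B.b + B.a * A.b - trace (A.z * conj B.z),
      conj A.z * conj B.y + conj B.z * conj A.y - A.a • B.x - B.a • A.x,
      conj A.x * conj B.z + conj B.x * conj A.z - A.b • B.y - B.b • A.y,
      conj A.y * conj B.x + conj B.y * conj A.x - A.c • B.z - B.c • A.z⟩ := by
  ext1 <;>
    simp only [cross, sharp, add_a', add_b', add_c', add_x', add_y', add_z', sub_a', sub_b',
      sub_c', sub_x', sub_y', sub_z', nrm_add, map_add, mul_add, add_mul]
  · ring
  · ring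
  · ring
  all_goals module

theorem cross_add (A B D : Herm3 C) : cross A (B + D) = cross A B + cross A D := by
  ext1 <;>
    simp only [cross_eq, add_a', add_b', add_c', add_x', add_y', add_z', map_add, mul_add,
      add_mul]
  · ring
  · ring
  · ring
  all_goals module

theorem cross_smul (n : ℤ) (A B : Herm3 C) : cross A (n • B) = n • cross A B := by
  ext1 <;>
    simp only [cross_eq, smul_a', smul_b', smul_c', smul_x', smul_y', smul_z', map_zsmul,
      smul_mul_assoc, mul_smul_comm, smul_eq_mul]
  · ring
  · ring
  · ring
  all_goals module

theorem cross_self (A : Herm3 C) : cross A A = (2 : ℤ) • sharp A := by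
  rw [cross, ← two_zsmul, sharp_smul]; module

theorem det_add (A B : Herm3 C) :
    det (A + B) = det A + bil (sharp A) B + bil A (sharp B) + det B := by
  have e : ∀ u v w : C, trace (conj u * conj v * conj w) = trace (w * v * u) := fun u v w => by
    rw [← conj_mul_rev, ← conj_mul_rev, trace_conj, trace_mul_assoc]
  have r : ∀ u v w : C, trace (u * v * w) = trace (v * w * u) := fun u v w => by
    rw [trace_mul_assoc, trace_mul_comm]
  rw [bil_symm A (sharp B)]
  simp only [det, bil, sharp, add_a', add_b', add_c', add_x', add_y', add_z', nrm_add, map_add,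
    mul_add, add_mul, sub_mul, map_sub, smul_mul_assoc, map_zsmul, smul_eq_mul, e]
  have s : ∀ u v : C, trace (u * conj v) = trace (v * conj u) := fun u v => by
    rw [← trace_conj (u * conj v), conj_mul_rev, conj_conj]
  rw [s B.x A.x, s B.y A.y, s B.z A.z, ← r A.x B.y A.z, ← r B.x A.y B.z, r B.z A.x A.y,
    r A.z B.x B.y]
  ring

theorem bil_cross_cycle (A B D : Herm3 C) : bil (cross A B) D = bil (cross B D) A := by
  have h1 := det_add (A + B) D
  have h2 := det_add A (B + D)
  have h3 := det_add A B
  have h4 := det_add B D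
  rw [← add_assoc] at h2
  rw [bil_symm _ D, sharp_add, bil_add, bil_add, bil_symm (A + B), bil_add] at h1
  rw [sharp_add B D, bil_add, bil_add, bil_add] at h2
  rw [bil_symm _ D, bil_symm _ A]
  linarith [bil_symm (sharp A) D, bil_symm (sharp B) D, bil_symm (sharp D) A,
    bil_symm (sharp D) B]

theorem bil_sharp_self (A : Herm3 C) : bil (sharp A) A = 3 * det A := by
  have h := det_add A A
  rw [← two_zsmul, det_smul, bil_symm A] at h
  linarith

theorem bil_nondegenerate (A : Herm3 C) (h : ∀ B, bil A B = 0) : A = 0 := by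
  have ha := h ⟨1, 0, 0, 0, 0, 0⟩
  have hb := h ⟨0, 1, 0, 0, 0, 0⟩
  have hc := h ⟨0, 0, 1, 0, 0, 0⟩
  have hx : A.x = 0 := trace_nondegenerate _ fun u => by
    simpa [bil] using h ⟨0, 0, 0, u, 0, 0⟩
  have hy : A.y = 0 := trace_nondegenerate _ fun u => by
    simpa [bil] using h ⟨0, 0, 0, 0, u, 0⟩
  have hz : A.z = 0 := trace_nondegenerate _ fun u => by
    simpa [bil] using h ⟨0, 0, 0, 0, 0, u⟩
  simp only [bil, map_zero, mul_zero, mul_one, add_zero, zero_add] at ha hb hc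
  exact Herm3.ext ha hb hc hx hy hz

end Herm3

/-! ### The Freudenthal construction -/

/-- The greatest integer dividing all elements of `S`. If every element of `S` is zero, so that
no greatest one exists, this is `0`. -/
noncomputable def gcdOf {V : Type} [AddCommGroup V] (S : Set V) : ℤ :=
  sSup {d : ℤ | ∀ v ∈ S, ∃ v' : V, v = d • v'}

/-- The full polarization of a map `f`. For a quartic form it is `24 f(x, y, z, w)`, where
`f(x, y, z, w)` is the symmetric four-linear form with `f(x, x, x, x) = f(x)`. -/
def polar4 {V : Type} [AddCommGroup V] (f : V → ℤ) (x y z w : V) : ℤ :=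
  f (x + y + z + w) - f (x + y + z) - f (x + y + w) - f (x + z + w) - f (y + z + w)
    + f (x + y) + f (x + z) + f (x + w) + f (y + z) + f (y + w) + f (z + w)
    - f x - f y - f z - f w

/-- The module `ℤ ⊕ ℤ ⊕ J ⊕ J` with `J` the Hermitian matrices over `C`; its elements are
`(α, β, A, B)`. -/
@[ext]
structure FreudenthalModule (C : Type) : Type where
  α : ℤ
  β : ℤ
  A : Herm3 C
  B : Herm3 C

namespace FreudenthalModule

theorem toTuple_injective {C : Type} :
    Function.Injective (fun x : FreudenthalModule C => (x.α, x.β, x.A, x.B)) := by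
  rintro ⟨_, _, _, _⟩ ⟨_, _, _, _⟩ h
  simpa using h

open Herm3

variable {C : Type} [CompositionRing C]

instance : Zero (FreudenthalModule C) := ⟨⟨0, 0, 0, 0⟩⟩
instance : Add (FreudenthalModule C) :=
  ⟨fun x y => ⟨x.α + y.α, x.β + y.β, x.A + y.A, x.B + y.B⟩⟩
instance : Neg (FreudenthalModule C) := ⟨fun x => ⟨-x.α, -x.β, -x.A, -x.B⟩⟩
instance : Sub (FreudenthalModule C) :=
  ⟨fun x y => ⟨x.α - y.α, x.β - y.β, x.A - y.A, x.B - y.B⟩⟩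
instance : SMul ℕ (FreudenthalModule C) := ⟨fun n x => ⟨n • x.α, n • x.β, n • x.A, n • x.B⟩⟩
instance : SMul ℤ (FreudenthalModule C) := ⟨fun n x => ⟨n • x.α, n • x.β, n • x.A, n • x.B⟩⟩

instance : AddCommGroup (FreudenthalModule C) :=
  toTuple_injective.addCommGroup _ rfl (fun _ _ => rfl) (fun _ => rfl) (fun _ _ => rfl)
    (fun _ _ => rfl) (fun _ _ => rfl)

@[simp] theorem add_α (x y : FreudenthalModule C) : (x + y).α = x.α + y.α := rfl
@[simp] theorem add_β (x y : FreudenthalModule C) : (x + y).β = x.β + y.β := rfl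
@[simp] theorem add_A (x y : FreudenthalModule C) : (x + y).A = x.A + y.A := rfl
@[simp] theorem add_B (x y : FreudenthalModule C) : (x + y).B = x.B + y.B := rfl

/-- The skew-symmetric bilinear form. -/
def symp (x y : FreudenthalModule C) : ℤ :=
  x.α * y.β - x.β * y.α + bil x.A y.B - bil x.B y.A

/-- The quartic form `q`. -/
def quartic (x : FreudenthalModule C) : ℤ :=
  8 * bil (sharp x.A) (sharp x.B) - 8 * x.α * det x.A - 8 * x.β * det x.B
    - 2 * (bil x.A x.B - x.α * x.β) ^ 2

/-- The modified quartic form `q'`, with `q = -2 q'`; this is the norm. -/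
def quartic' (x : FreudenthalModule C) : ℤ :=
  -4 * bil (sharp x.A) (sharp x.B) + 4 * x.α * det x.A + 4 * x.β * det x.B
    + (bil x.A x.B - x.α * x.β) ^ 2

/-- The group of invertible linear transformations that preserve `{·,·}` and `q`. -/
def autGroup (C : Type) [CompositionRing C] :
    Subgroup (FreudenthalModule C ≃ₗ[ℤ] FreudenthalModule C) where
  carrier := {g | (∀ x y, symp (g x) (g y) = symp x y) ∧ ∀ x, quartic (g x) = quartic x}
  one_mem' := ⟨fun _ _ => rfl, fun _ => rfl⟩
  mul_mem' := fun {g h} hg hh =>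
    ⟨fun x y => (hg.1 (h x) (h y)).trans (hh.1 x y), fun x => (hg.2 (h x)).trans (hh.2 x)⟩
  inv_mem' := fun {g} hg => by
    have e : ∀ x, g (g⁻¹ x) = x := fun x => g.apply_symm_apply x
    refine ⟨fun x y => ?_, fun x => ?_⟩
    · rw [← hg.1, e, e]
    · rw [← hg.2, e]

/-- Two elements are equivalent if they lie in one orbit of the group. -/
def Equivalent (x y : FreudenthalModule C) : Prop := ∃ g ∈ autGroup C, g x = y

/-- The element `T(x, x, x)`, where `T` is determined by `{T(x, y, z), w} = q(x, y, z, w)`;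
see `tripleT_spec` and `symp_nondegenerate`. -/
def tripleT (x : FreudenthalModule C) : FreudenthalModule C where
  α := -x.α ^ 2 * x.β + x.α * bil x.A x.B - 2 * det x.B
  β := x.α * x.β ^ 2 - x.β * bil x.A x.B + 2 * det x.A
  A := (2 : ℤ) • cross x.B (sharp x.A) - (2 * x.β) • sharp x.B
    - (bil x.A x.B - x.α * x.β) • x.A
  B := -((2 : ℤ) • cross x.A (sharp x.B)) + (2 * x.α) • sharp x.A
    + (bil x.A x.B - x.α * x.β) • x.B

/-- The element `3 T(x, x, y)`; see `tripleTLin_spec` and `symp_nondegenerate`. -/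
def tripleTLin (x y : FreudenthalModule C) : FreudenthalModule C where
  α := -2 * x.α * x.β * y.α - x.α ^ 2 * y.β + y.α * bil x.A x.B + x.α * bil y.A x.B
    + x.α * bil x.A y.B - 2 * bil (sharp x.B) y.B
  β := y.α * x.β ^ 2 + 2 * x.α * x.β * y.β - y.β * bil x.A x.B - x.β * bil y.A x.B
    - x.β * bil x.A y.B + 2 * bil (sharp x.A) y.A
  A := -((bil y.A x.B + bil x.A y.B - x.α * y.β - x.β * y.α) • x.A)
    - (bil x.A x.B - x.α * x.β) • y.A - (2 * y.β) • sharp x.B - (2 * x.β) • cross x.B y.B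
    + (2 : ℤ) • cross y.B (sharp x.A) + (2 : ℤ) • cross x.B (cross x.A y.A)
  B := (bil y.A x.B + bil x.A y.B - x.α * y.β - x.β * y.α) • x.B
    + (bil x.A x.B - x.α * x.β) • y.B + (2 * y.α) • sharp x.A + (2 * x.α) • cross x.A y.A
    - (2 : ℤ) • cross y.A (sharp x.B) - (2 : ℤ) • cross x.A (cross x.B y.B)

theorem symp_nondegenerate (x : FreudenthalModule C) (h : ∀ w, symp x w = 0) : x = 0 := by
  have hz : ∀ D : Herm3 C, bil D 0 = 0 := fun D => by simpa using bil_smul 0 D D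
  have h1 := h ⟨0, 1, 0, 0⟩
  have h2 := h ⟨1, 0, 0, 0⟩
  have hA : x.A = 0 := bil_nondegenerate _ fun D => by
    simpa [symp, hz] using h ⟨0, 0, 0, D⟩
  have hB : x.B = 0 := bil_nondegenerate _ fun D => by
    simpa [symp, hz] using h ⟨0, 0, D, 0⟩
  simp [symp, hz] at h1 h2
  exact FreudenthalModule.ext h1 h2 hA hB

theorem bil_add_left (A B D : Herm3 C) : bil (A + B) D = bil A D + bil B D := by
  rw [bil_symm, bil_add, bil_symm D, bil_symm D]

theorem bil_smul_left (n : ℤ) (A D : Herm3 C) : bil (n • A) D = n * bil A D := by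
  rw [bil_symm, bil_smul, bil_symm D]

theorem bil_neg_left (A D : Herm3 C) : bil (-A) D = -bil A D := by
  rw [← neg_one_zsmul, bil_smul_left]; ring

theorem bil_sub_left (A B D : Herm3 C) : bil (A - B) D = bil A D - bil B D := by
  rw [sub_eq_add_neg, bil_add_left, bil_neg_left]; ring

theorem cross_add_left (A B D : Herm3 C) : cross (A + B) D = cross A D + cross B D := by
  rw [cross_comm, cross_add, cross_comm D, cross_comm D]

theorem tripleTLin_spec (x y w : FreudenthalModule C) :
    8 * symp (tripleTLin x y) w = polar4 quartic x x y w := by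
  obtain ⟨α, β, A, B⟩ := x
  obtain ⟨γ, δ, D, E⟩ := y
  obtain ⟨ζ, η, F, G⟩ := w
  have s3 : ∀ X : Herm3 C, bil X (sharp X) = 3 * det X := fun X => by
    rw [bil_symm, bil_sharp_self]
  have c0 : ∀ X Y Z : Herm3 C, bil (cross X Y) Z = bil X (cross Y Z) := fun X Y Z => by
    rw [bil_cross_cycle, bil_symm]
  simp only [polar4, symp, tripleTLin, quartic, add_α, add_β, add_A, add_B, bil_add_left,
    bil_sub_left, bil_neg_left, bil_smul_left, bil_smul, bil_add, sharp_add, det_add, s3,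
    bil_sharp_self, cross_add_left, Herm3.cross_self]
  have e1 : bil (cross D F) (sharp B) = bil (cross D (sharp B)) F := by
    rw [cross_comm D (sharp B), c0 (sharp B), bil_symm]
  have e2 : bil (cross A F) (cross B E) = bil (cross A (cross B E)) F := by
    rw [cross_comm A (cross B E), c0 (cross B E), bil_symm]
  have e3 : bil (cross A D) (cross B G) = bil (cross B (cross A D)) G := by
    rw [cross_comm B (cross A D), c0 (cross A D)]
  have e4 : bil (sharp A) (cross E G) = bil (cross E (sharp A)) G := by
    rw [cross_comm E (sharp A), c0 (sharp A)]
  rw [e1, e2, e3, e4, bil_symm F E, bil_symm F B]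
  ring

theorem tripleT_spec (x w : FreudenthalModule C) :
    24 * symp (tripleT x) w = polar4 quartic x x x w := by
  have h : (3 : ℤ) * symp (tripleT x) w = symp (tripleTLin x x) w := by
    simp only [symp, tripleT, tripleTLin, bil_add_left, bil_sub_left, bil_neg_left,
      bil_smul_left, bil_sharp_self, Herm3.cross_self, cross_smul]
    ring
  have h1 := tripleTLin_spec x x w
  linarith

/-- The rank: it is `4` iff `q(x) ≠ 0`, at most `3` iff `q(x) = 0`, at most `2` iff
`T(x, x, x) = 0`, at most `1` iff `3 T(x, x, y) + {x, y} x = 0` for all `y`, and `0` iff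
`x = 0`. -/
noncomputable def rank (x : FreudenthalModule C) : ℕ :=
  open Classical in
  if x = 0 then 0
  else if ∀ y, tripleTLin x y + symp x y • x = 0 then 1
  else if tripleT x = 0 then 2
  else if quartic x = 0 then 3
  else 4

/-- The invariant `d₁`: the gcd of the element. -/
noncomputable def d₁ (x : FreudenthalModule C) : ℤ := gcdOf {x}

/-- The invariant `d₂`: the gcd of all `3 T(x, x, y) + {x, y} x`. -/
noncomputable def d₂ (x : FreudenthalModule C) : ℤ :=
  gcdOf (Set.range fun y => tripleTLin x y + symp x y • x)

/-- The integral binary quadratic form `a X² + b X Y + c Y²` is primitive. -/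
def PrimitiveForm (a b c : ℤ) : Prop := Int.gcd a (Int.gcd b c) = 1

/-- The element `(α, β, (a₁, a₂, a₃), (b₁, b₂, b₃))` of the module built from the diagonal algebra
`ℤ ⊕ ℤ ⊕ ℤ` is projective: its three associated binary quadratic forms are primitive. -/
def DiagonalProjective (α β a₁ a₂ a₃ b₁ b₂ b₃ : ℤ) : Prop :=
  PrimitiveForm (α * a₁ - b₂ * b₃) (-(a₁ * b₁) + a₂ * b₂ + a₃ * b₃ - α * β) (β * b₁ - a₂ * a₃) ∧
  PrimitiveForm (α * a₂ - b₃ * b₁) (a₁ * b₁ - a₂ * b₂ + a₃ * b₃ - α * β) (β * b₂ - a₃ * a₁) ∧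
  PrimitiveForm (α * a₃ - b₁ * b₂) (a₁ * b₁ + a₂ * b₂ - a₃ * b₃ - α * β) (β * b₃ - a₁ * a₂)

/-- An element is projective if its orbit contains a diagonal reduced element which is
projective. -/
def Projective (x : FreudenthalModule C) : Prop :=
  ∃ α β a₁ a₂ a₃ : ℤ, 0 < α ∧ α ∣ β ∧ α ∣ a₁ ∧ α ∣ a₂ ∧ α ∣ a₃ ∧
    Equivalent x ⟨α, β, diag a₁ a₂ a₃, 0⟩ ∧ DiagonalProjective α β a₁ a₂ a₃ 0 0 0

end FreudenthalModule

/-! Three kinds of group elements suffice: contragredient pairs of norm preserving maps on Hermitian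
matrices (row additions and the cyclic permutation), the exchange of the two halves, and the
translations by `diag t 0 0`. These matrices have zero adjoint, which keeps their translations
linear in `t`. The effect of other translations comes from conjugating and composing.

Reduction is a Euclidean descent. In the orbit of a nonzero element, take the first coordinate `α`
positive and minimal. A nonzero remainder modulo `α` in the last component could be moved into the
first coordinate and make it smaller, so `α` divides the last component; that component is then
cleared, and `α` divides all that remains (`exists_reduced`). Rank one now kills everything but `α`.
Rank two leaves a nonzero matrix with zero adjoint, and a second descent, on its upper left corner,
leaves a single diagonal entry (`exists_normEquivalent_diag`). The group commutes with `T`, so `d₁`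
and `d₂` are orbit invariants, and they separate these normal forms.

For a projective element primitivity gives `α = 1`. Suitable composites of translations act on `(1,
β, diag a b c, 0)` as unipotent substitutions in the binary form with coefficients `a`, `β`, `-bc`
(`Equivalent.shift`), and primitivity lets them make the diagonal pairwise coprime. An element of
norm zero and trace one then merges two coprime entries into `1` and their product
(`diag_of_isCoprime`), so only the product of all three survives. A last substitution brings `β` to
`0` or `1`, and `q' = ε² + 4k` determines both parameters. -/

/-! ### Identities in composition rings. -/

namespace CompositionRing

variable {C : Type} [CompositionRing C]

theorem trace_mul_conj_symm (u v : C) : trace (u * conj v) = trace (v * conj u) := by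
  rw [← trace_conj (u * conj v), conj_mul_rev, conj_conj]

theorem trace_conj_mul (u v : C) : trace (conj u * v) = trace (u * conj v) := by
  rw [trace_mul_comm, trace_mul_conj_symm]

theorem trace_mul_conj_self (u : C) : trace (u * conj u) = 2 * nrm u := by
  rw [mul_conj, map_zsmul, trace_one, smul_eq_mul, mul_comm]

theorem nrm_conj (u : C) : nrm (conj u) = nrm u := by
  have h := trace_mul_conj_self (conj u)
  rw [trace_conj_mul, conj_conj, trace_mul_conj_self] at h
  linarith

theorem nrm_neg (u : C) : nrm (-u) = nrm u := by
  have h := trace_mul_conj_self (-u)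
  rw [map_neg, neg_mul_neg, trace_mul_conj_self] at h
  linarith

theorem nrm_zero : nrm (0 : C) = 0 := by
  have h := trace_mul_conj_self (0 : C)
  rw [zero_mul, map_zero] at h
  linarith

/-- Polarization of the multiplicativity of the norm. -/
theorem trace_mul_mul_conj (u x y : C) :
    trace ((u * x) * conj (u * y)) = nrm u * trace (x * conj y) := by
  have h := nrm_add (u * x) (u * y)
  rw [← mul_add, nrm_mul, nrm_mul, nrm_mul, nrm_add] at h
  linarith

theorem trace_mul_mul_conj_right (u x y : C) :
    trace ((x * u) * conj (y * u)) = nrm u * trace (x * conj y) := by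
  have h := nrm_add (x * u) (y * u)
  rw [← add_mul, nrm_mul, nrm_mul, nrm_mul, nrm_add] at h
  linarith

theorem trace_rotate (x y z : C) : trace ((x * y) * z) = trace ((y * z) * x) := by
  rw [trace_mul_assoc, trace_mul_comm]

/-- A weak form of the alternative law `x (x̄ u) = n(x) u`, tested against the trace. It follows
from composition alone, and takes the place of associativity for octonions. -/
theorem trace_mul_conj_mul_mul (x u z : C) :
    trace ((x * (conj x * u)) * z) = nrm x * trace (u * z) := by
  have h := trace_mul_mul_conj (conj x) u (conj z)
  rw [conj_mul_rev, conj_conj, conj_conj, nrm_conj] at h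
  rw [← h, trace_rotate, trace_mul_assoc]

theorem trace_mul_conj_mul (v y z : C) :
    trace (v * conj y * y * z) = nrm y * trace (v * z) := by
  have h := trace_mul_mul_conj_right (conj y) v (conj z)
  rw [conj_mul_rev, conj_conj, conj_conj, nrm_conj] at h
  rw [← h, trace_mul_assoc]

theorem trace_conj_conj_conj (u v w : C) :
    trace (conj u * conj v * conj w) = trace (w * v * u) := by
  rw [← conj_mul_rev, ← conj_mul_rev, trace_conj, trace_mul_assoc]

end CompositionRing

/-! ### Row operations on Hermitian matrices. -/

namespace Herm3

open CompositionRing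

variable {C : Type} [CompositionRing C]

/-- Adding `u` times the second row to the first row, and the same for the columns. -/
def rowAdd₁₂ (u : C) : Herm3 C ≃+ Herm3 C where
  toFun A := ⟨A.a + trace (A.z * conj u) + A.b * nrm u, A.b, A.c, A.x,
    A.y + conj A.x * conj u, A.z + A.b • u⟩
  invFun A := ⟨A.a - trace (A.z * conj u) + A.b * nrm u, A.b, A.c, A.x,
    A.y - conj A.x * conj u, A.z - A.b • u⟩
  left_inv A := by
    ext1 <;> simp only [add_mul, map_add, smul_mul_assoc, map_zsmul, smul_eq_mul,
      trace_mul_conj_self, add_sub_cancel_right]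
    ring
  right_inv A := by
    ext1 <;> simp only [sub_mul, map_sub, smul_mul_assoc, map_zsmul, smul_eq_mul,
      trace_mul_conj_self, sub_add_cancel]
    ring
  map_add' A B := by
    ext1 <;> simp only [add_a', add_b', add_c', add_x', add_y', add_z', add_mul, map_add]
    · ring
    · abel
    · module

/-- Adding `conj u` times the first row to the second row, and the same for the columns. -/
def rowAdd₂₁ (u : C) : Herm3 C ≃+ Herm3 C where
  toFun A := ⟨A.a, A.b + trace (A.z * conj u) + A.a * nrm u, A.c,
    A.x + conj u * conj A.y, A.y, A.z + A.a • u⟩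
  invFun A := ⟨A.a, A.b - trace (A.z * conj u) + A.a * nrm u, A.c,
    A.x - conj u * conj A.y, A.y, A.z - A.a • u⟩
  left_inv A := by
    ext1 <;> simp only [add_mul, map_add, smul_mul_assoc, map_zsmul, smul_eq_mul,
      trace_mul_conj_self, add_sub_cancel_right]
    ring
  right_inv A := by
    ext1 <;> simp only [sub_mul, map_sub, smul_mul_assoc, map_zsmul, smul_eq_mul,
      trace_mul_conj_self, sub_add_cancel]
    ring
  map_add' A B := by
    ext1 <;> simp only [add_a', add_b', add_c', add_x', add_y', add_z', add_mul, mul_add, map_add]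
    · ring
    · abel
    · module

/-- The cyclic permutation of the three indices. -/
def rotate : Herm3 C ≃+ Herm3 C where
  toFun A := ⟨A.b, A.c, A.a, A.y, A.z, A.x⟩
  invFun A := ⟨A.c, A.a, A.b, A.z, A.x, A.y⟩
  left_inv _ := rfl
  right_inv _ := rfl
  map_add' _ _ := rfl

theorem det_rowAdd₁₂ (u : C) (A : Herm3 C) : det (rowAdd₁₂ u A) = det A := by
  obtain ⟨a, b, c, x, y, z⟩ := A
  have h1 : trace (x * (conj x * conj u) * z) = nrm x * trace (z * conj u) := by
    rw [trace_mul_conj_mul_mul, trace_mul_comm]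
  have h2 : trace (x * (conj x * conj u) * u) = nrm x * (2 * nrm u) := by
    rw [trace_mul_conj_mul_mul, trace_mul_comm, trace_mul_conj_self]
  have h3 : trace (y * (u * x)) = trace (x * y * u) := by
    rw [← trace_mul_assoc, trace_rotate, trace_rotate, trace_rotate]
  simp only [det, rowAdd₁₂, AddEquiv.coe_mk, Equiv.coe_fn_mk, nrm_add, mul_add, add_mul, map_add,
    nrm_smul, map_zsmul, mul_smul_comm, smul_eq_mul, h1, h2, nrm_mul, nrm_conj, conj_mul_rev,
    conj_conj, h3]
  ring

theorem det_rowAdd₂₁ (u : C) (A : Herm3 C) : det (rowAdd₂₁ u A) = det A := by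
  obtain ⟨a, b, c, x, y, z⟩ := A
  have h1 : trace (conj u * conj y * y * z) = nrm y * trace (z * conj u) := by
    rw [trace_mul_conj_mul, trace_conj_mul, trace_mul_conj_symm]
  have h2 : trace (conj u * conj y * y * u) = nrm y * (2 * nrm u) := by
    rw [trace_mul_conj_mul, trace_conj_mul, trace_mul_conj_self]
  have h3 : trace (x * (y * u)) = trace (x * y * u) := by
    rw [trace_mul_assoc]
  simp only [det, rowAdd₂₁, AddEquiv.coe_mk, Equiv.coe_fn_mk, nrm_add, mul_add, add_mul, map_add,
    nrm_smul, map_zsmul, mul_smul_comm, smul_eq_mul, h1, h2, nrm_mul, nrm_conj, conj_mul_rev,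
    conj_conj, h3]
  ring

theorem det_rotate (A : Herm3 C) : det (rotate A) = det A := by
  simp only [det, rotate, AddEquiv.coe_mk, Equiv.coe_fn_mk]
  rw [trace_rotate A.x]
  ring

/-- Over an associative ring the maps are `A ↦ g A g*` and `B ↦ g⁻* B g⁻¹` with `g` elementary,
which explains the sign and the transposed position. -/
theorem bil_rowAdd (u : C) (A B : Herm3 C) :
    bil (rowAdd₁₂ u A) (rowAdd₂₁ (-u) B) = bil A B := by
  obtain ⟨a, b, c, x, y, z⟩ := A
  obtain ⟨a', b', c', x', y', z'⟩ := B
  simp only [bil, rowAdd₁₂, rowAdd₂₁, AddEquiv.coe_mk, Equiv.coe_fn_mk, mul_add, add_mul, map_add,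
    map_zsmul, mul_smul_comm, smul_mul_assoc, smul_eq_mul, map_neg, neg_mul, mul_neg,
    conj_mul_rev, conj_conj, nrm_neg, trace_mul_conj_self]
  have h1 : trace (conj x * conj u * conj y') = trace (x * (y' * u)) := by
    rw [trace_conj_conj_conj, trace_rotate, trace_rotate, trace_mul_assoc]
  rw [h1, trace_mul_conj_symm z' u]
  simp
  ring

theorem bil_rotate (A B : Herm3 C) : bil (rotate A) (rotate B) = bil A B := by
  simp only [bil, rotate, AddEquiv.coe_mk, Equiv.coe_fn_mk]
  ring

end Herm3

/-! ### Contragredient pairs of norm preserving maps. -/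

namespace Herm3

open CompositionRing

variable {C : Type} [CompositionRing C]

/-- Two norm preserving automorphisms that are contragredient for the trace form. -/
structure IsNormPair (s s' : Herm3 C ≃+ Herm3 C) : Prop where
  bil_map : ∀ A B, bil (s A) (s' B) = bil A B
  det_left : ∀ A, det (s A) = det A
  det_right : ∀ A, det (s' A) = det A

namespace IsNormPair

variable {s s' t t' : Herm3 C ≃+ Herm3 C}

theorem refl : IsNormPair (AddEquiv.refl (Herm3 C)) (AddEquiv.refl _) :=
  ⟨fun _ _ => rfl, fun _ => rfl, fun _ => rfl⟩

theorem dual (h : IsNormPair s s') : IsNormPair s' s :=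
  ⟨fun A B => by rw [bil_symm, h.bil_map, bil_symm], h.det_right, h.det_left⟩

theorem symm (h : IsNormPair s s') : IsNormPair s.symm s'.symm :=
  ⟨fun A B => by rw [← h.bil_map, s.apply_symm_apply, s'.apply_symm_apply],
    fun A => by rw [← h.det_left, s.apply_symm_apply],
    fun A => by rw [← h.det_right, s'.apply_symm_apply]⟩

theorem trans (h : IsNormPair s s') (k : IsNormPair t t') :
    IsNormPair (s.trans t) (s'.trans t') :=
  ⟨fun A B => by simp [h.bil_map, k.bil_map], fun A => by simp [h.det_left, k.det_left],
    fun A => by simp [h.det_right, k.det_right]⟩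

theorem rowAdd (u : C) : IsNormPair (rowAdd₁₂ u) (rowAdd₂₁ (-u)) :=
  ⟨bil_rowAdd u, det_rowAdd₁₂ u, det_rowAdd₂₁ (-u)⟩

theorem rowAdd' (u : C) : IsNormPair (rowAdd₂₁ u) (rowAdd₁₂ (-u)) := by
  simpa using (rowAdd (-u)).dual

theorem rotate : IsNormPair (rotate (C := C)) rotate :=
  ⟨bil_rotate, det_rotate, det_rotate⟩

/-- The adjoint is determined by the cubic form and the trace form: `key` recovers `(X^#, Y)` from
values of `det`, and the trace form is nondegenerate. So the quartic form is preserved without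
further computation. -/
theorem sharp_left (h : IsNormPair s s') (A : Herm3 C) : sharp (s A) = s' (sharp A) := by
  have key : ∀ X Y : Herm3 C, 2 * bil (sharp X) Y = det (X + Y) - det (X - Y) - 2 * det Y := by
    intro X Y
    have h1 := det_add X Y
    have h2 := det_add X (-Y)
    have e1 : sharp (-Y) = sharp Y := by simpa using sharp_smul (-1) Y
    have e2 : det (-Y) = -det Y := by simpa using det_smul (-1) Y
    have e3 : bil (sharp X) (-Y) = -bil (sharp X) Y := by simpa using bil_smul (-1) (sharp X) Y
    rw [e1, e2, e3, ← sub_eq_add_neg] at h2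
    linarith
  rw [← sub_eq_zero]
  refine bil_nondegenerate _ fun B => ?_
  obtain ⟨B, rfl⟩ := s.surjective B
  have h1 := key (s A) (s B)
  rw [← map_add, ← map_sub, h.det_left, h.det_left, h.det_left, ← key A B] at h1
  rw [FreudenthalModule.bil_sub_left, h.dual.bil_map]
  linarith

end IsNormPair

@[simp] theorem zero_a' : (0 : Herm3 C).a = 0 := rfl
@[simp] theorem zero_b' : (0 : Herm3 C).b = 0 := rfl
@[simp] theorem zero_c' : (0 : Herm3 C).c = 0 := rfl
@[simp] theorem zero_x' : (0 : Herm3 C).x = 0 := rfl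
@[simp] theorem zero_y' : (0 : Herm3 C).y = 0 := rfl
@[simp] theorem zero_z' : (0 : Herm3 C).z = 0 := rfl
@[simp] theorem neg_a' (A : Herm3 C) : (-A).a = -A.a := rfl
@[simp] theorem neg_b' (A : Herm3 C) : (-A).b = -A.b := rfl
@[simp] theorem neg_c' (A : Herm3 C) : (-A).c = -A.c := rfl
@[simp] theorem neg_x' (A : Herm3 C) : (-A).x = -A.x := rfl
@[simp] theorem neg_y' (A : Herm3 C) : (-A).y = -A.y := rfl
@[simp] theorem neg_z' (A : Herm3 C) : (-A).z = -A.z := rfl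

/-- Two Hermitian matrices are norm equivalent if some norm pair carries one to the other. -/
def NormEquivalent (A B : Herm3 C) : Prop :=
  ∃ s s' : Herm3 C ≃+ Herm3 C, IsNormPair s s' ∧ s A = B

namespace NormEquivalent

theorem refl (A : Herm3 C) : NormEquivalent A A := ⟨_, _, IsNormPair.refl, rfl⟩

theorem trans {A B D : Herm3 C} (h : NormEquivalent A B) (k : NormEquivalent B D) :
    NormEquivalent A D := by
  obtain ⟨s, s', hs, rfl⟩ := h
  obtain ⟨t, t', ht, rfl⟩ := k
  exact ⟨_, _, hs.trans ht, rfl⟩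

theorem rowAdd₁₂ (u : C) (A : Herm3 C) : NormEquivalent A (Herm3.rowAdd₁₂ u A) :=
  ⟨_, _, IsNormPair.rowAdd u, rfl⟩

theorem rowAdd₂₁ (u : C) (A : Herm3 C) : NormEquivalent A (Herm3.rowAdd₂₁ u A) :=
  ⟨_, _, IsNormPair.rowAdd' u, rfl⟩

theorem rotate (A : Herm3 C) : NormEquivalent A (Herm3.rotate A) :=
  ⟨_, _, IsNormPair.rotate, rfl⟩

theorem sharp_eq_zero {A B : Herm3 C} (h : NormEquivalent A B) (hA : sharp A = 0) :
    sharp B = 0 := by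
  obtain ⟨s, s', hs, rfl⟩ := h
  rw [hs.sharp_left, hA, map_zero]

end NormEquivalent

end Herm3

/-! ### Generators of the group. -/

namespace FreudenthalModule

open CompositionRing Herm3

variable {C : Type} [CompositionRing C]

theorem quartic_eq (x : FreudenthalModule C) : quartic x = -2 * quartic' x := by
  simp only [quartic, quartic']; ring

theorem symp_add_left (x y z : FreudenthalModule C) : symp (x + y) z = symp x z + symp y z := by
  simp only [symp, add_α, add_β, add_A, add_B, bil_add_left]; ring

theorem symp_neg_left (x z : FreudenthalModule C) : symp (-x) z = -symp x z := by
  have h := symp_add_left (-x) x z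
  have h0 := symp_add_left 0 0 z
  rw [add_zero] at h0
  rw [neg_add_cancel] at h
  linarith

theorem symp_sub_left (x y z : FreudenthalModule C) : symp (x - y) z = symp x z - symp y z := by
  rw [sub_eq_add_neg, symp_add_left, symp_neg_left]; ring

theorem symp_left_injective {x y : FreudenthalModule C} (h : ∀ w, symp x w = symp y w) :
    x = y := by
  rw [← sub_eq_zero]
  exact symp_nondegenerate _ fun w => by rw [symp_sub_left, h, sub_self]

/-- A surjective map that preserves `{·,·}` and `q'` is automatically linear and bijective. -/
theorem equivalent_of_surjective (g : FreudenthalModule C → FreudenthalModule C)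
    (hg : Function.Surjective g) (hs : ∀ x y, symp (g x) (g y) = symp x y)
    (hq : ∀ x, quartic' (g x) = quartic' x) (x : FreudenthalModule C) :
    Equivalent x (g x) := by
  have hi : Function.Injective g := fun x y h => symp_left_injective fun w => by
    rw [← hs, h, hs]
  let f : FreudenthalModule C →+ FreudenthalModule C := AddMonoidHom.mk' g fun x y =>
    symp_left_injective fun w => by
      obtain ⟨w, rfl⟩ := hg w
      rw [hs, symp_add_left, symp_add_left, hs, hs]
  refine ⟨(AddEquiv.ofBijective f ⟨hi, hg⟩).toIntLinearEquiv, ⟨hs, fun x => ?_⟩, rfl⟩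
  rw [quartic_eq, quartic_eq x]
  exact congrArg _ (hq x)

namespace Equivalent

theorem refl (x : FreudenthalModule C) : Equivalent x x :=
  ⟨1, (autGroup C).one_mem, rfl⟩

theorem symm {x y : FreudenthalModule C} (h : Equivalent x y) : Equivalent y x := by
  obtain ⟨g, hg, rfl⟩ := h
  exact ⟨g⁻¹, (autGroup C).inv_mem hg, g.symm_apply_apply x⟩

theorem trans {x y z : FreudenthalModule C} (h : Equivalent x y) (k : Equivalent y z) :
    Equivalent x z := by
  obtain ⟨g, hg, rfl⟩ := h
  obtain ⟨f, hf, rfl⟩ := k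
  exact ⟨f * g, (autGroup C).mul_mem hf hg, rfl⟩

theorem quartic'_eq {x y : FreudenthalModule C} (h : Equivalent x y) :
    quartic' y = quartic' x := by
  obtain ⟨g, hg, rfl⟩ := h
  have := hg.2 x
  rw [quartic_eq, quartic_eq] at this
  linarith

theorem of_isNormPair {s s' : Herm3 C ≃+ Herm3 C} (h : IsNormPair s s') (α β : ℤ)
    (A B : Herm3 C) : Equivalent ⟨α, β, A, B⟩ ⟨α, β, s A, s' B⟩ := by
  refine equivalent_of_surjective (fun x => ⟨x.α, x.β, s x.A, s' x.B⟩) (fun x => ?_)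
    (fun x y => ?_) (fun x => ?_) _
  · exact ⟨⟨x.α, x.β, s.symm x.A, s'.symm x.B⟩, by simp⟩
  · simp only [symp, h.bil_map, h.dual.bil_map]
  · simp only [quartic', h.sharp_left, h.dual.sharp_left, h.dual.bil_map, h.bil_map, h.det_left,
      h.det_right]

theorem of_normEquivalent {A B : Herm3 C} (h : NormEquivalent A B) (α β : ℤ) :
    Equivalent ⟨α, β, A, 0⟩ ⟨α, β, B, 0⟩ := by
  obtain ⟨s, s', hs, rfl⟩ := h
  simpa using of_isNormPair hs α β A 0

theorem exchange (α β : ℤ) (A B : Herm3 C) : Equivalent ⟨α, β, A, B⟩ ⟨-β, α, -B, A⟩ := by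
  have e1 : ∀ Y : Herm3 C, sharp (-Y) = sharp Y := fun Y => by simpa using sharp_smul (-1) Y
  have e2 : ∀ Y : Herm3 C, det (-Y) = -det Y := fun Y => by simpa using det_smul (-1) Y
  refine equivalent_of_surjective (fun x => ⟨-x.β, x.α, -x.B, x.A⟩) (fun x => ?_)
    (fun x y => ?_) (fun x => ?_) _
  · exact ⟨⟨x.β, -x.α, x.B, -x.A⟩, by simp⟩
  · simp only [symp, bil_neg_left]
    rw [bil_symm x.A, bil_neg_left, bil_symm x.B y.A, bil_symm y.B]
    ring
  · simp only [quartic', e1, e2, bil_neg_left]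
    rw [bil_symm x.B, bil_symm (sharp x.B)]
    ring

/-- The square of the exchange is minus the identity. -/
theorem neg (x : FreudenthalModule C) : Equivalent x (-x) :=
  (exchange x.α x.β x.A x.B).trans (exchange (-x.β) x.α (-x.B) x.A)

/-- The translation by the rank one element `diag(t, 0, 0)`. -/
theorem translate (t α β : ℤ) (A B : Herm3 C) : Equivalent ⟨α, β, A, B⟩
    ⟨α + t * B.a, β, ⟨A.a + t * β, A.b, A.c, A.x, A.y, A.z⟩,
      ⟨B.a, B.b + t * A.c, B.c + t * A.b, B.x - t • A.x, B.y, B.z⟩⟩ := by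
  -- The matrix `diag(t, 0, 0)` has zero adjoint and zero norm, so the terms of degree two and three
  -- in `t` of a general translation are absent.
  refine equivalent_of_surjective (fun x => ⟨x.α + t * x.B.a, x.β,
    ⟨x.A.a + t * x.β, x.A.b, x.A.c, x.A.x, x.A.y, x.A.z⟩,
      ⟨x.B.a, x.B.b + t * x.A.c, x.B.c + t * x.A.b, x.B.x - t • x.A.x, x.B.y, x.B.z⟩⟩)
    (fun x => ?_) (fun x y => ?_) (fun x => ?_) ⟨α, β, A, B⟩
  · exact ⟨⟨x.α - t * x.B.a, x.β,
    ⟨x.A.a - t * x.β, x.A.b, x.A.c, x.A.x, x.A.y, x.A.z⟩,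
      ⟨x.B.a, x.B.b - t * x.A.c, x.B.c - t * x.A.b, x.B.x + t • x.A.x, x.B.y, x.B.z⟩⟩, by simp⟩
  · simp only [symp, bil, sub_mul, map_sub, mul_sub, map_zsmul, smul_mul_assoc, mul_smul_comm,
      smul_eq_mul]
    rw [trace_mul_conj_symm x.A.x y.A.x]
    ring
  · obtain ⟨α, β, ⟨a, b, c, x, y, z⟩, ⟨a', b', c', x', y', z'⟩⟩ := x
    have hn : nrm (x' - t • x) = nrm x' - t * trace (x * conj x') + t ^ 2 * nrm x := by
      rw [sub_eq_add_neg, ← neg_smul, nrm_add, nrm_smul, map_zsmul, mul_smul_comm, map_zsmul,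
        trace_mul_conj_symm, smul_eq_mul]
      ring
    have h1 : ∀ u v w : C, trace (u * (v * w)) = trace (u * v * w) := fun u v w => by
      rw [trace_mul_assoc]
    have h2 : trace (conj x * conj z * z' * x) = nrm x * trace (z * conj z') := by
      rw [trace_rotate, trace_rotate, trace_mul_conj_mul_mul, trace_conj_mul]
    have h3 : trace (conj y * conj x * x * y') = nrm x * trace (y * conj y') := by
      rw [trace_mul_conj_mul, trace_conj_mul]
    simp only [quartic', bil, det, sharp, sub_mul, map_sub, mul_sub, map_zsmul, smul_mul_assoc,
      mul_smul_comm, smul_eq_mul, hn, conj_mul_rev, conj_conj, h1, h2, h3, trace_conj_conj_conj,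
      trace_mul_conj_self]
    rw [trace_rotate y z' x, trace_rotate z x y', trace_rotate x y' z]
    ring

/-- The contragredient translation by `diag(t, 0, 0)`. -/
theorem translate' (t α β : ℤ) (A B : Herm3 C) : Equivalent ⟨α, β, A, B⟩
    ⟨α, β + t * A.a, ⟨A.a, A.b + t * B.c, A.c + t * B.b, A.x - t • B.x, A.y, A.z⟩,
      ⟨B.a + t * α, B.b, B.c, B.x, B.y, B.z⟩⟩ := by
  -- Conjugation by the exchange; its sign turns `t` into `-t`.
  refine ((exchange α β A B).trans (translate (-t) (-β) α (-B) A)).trans (symm ?_)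
  have h := exchange α (β + t * A.a)
    ⟨A.a, A.b + t * B.c, A.c + t * B.b, A.x - t • B.x, A.y, A.z⟩
    ⟨B.a + t * α, B.b, B.c, B.x, B.y, B.z⟩
  convert h using 2
  · ring
  · ext1 <;> simp only [neg_a', neg_b', neg_c', neg_x', neg_y', neg_z']
    ring
  · simp only [neg_b', neg_c', neg_x']
    ext1 <;> simp only [neg_smul, smul_neg, neg_neg, neg_mul, mul_neg]

end Equivalent

end FreudenthalModule

/-! ### Split composition rings. -/

/-- A composition ring that contains a nontrivial idempotent, and in which divisibility can be
tested by pairing with unimodular elements of norm zero. -/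
structure CompositionRing.IsSplit (C : Type) [CompositionRing C] : Prop where
  exists_eq_smul : ∀ (d : ℤ) (z : C), (∀ u w : C, CompositionRing.nrm u = 0 →
    CompositionRing.trace (w * CompositionRing.conj u) = 1 →
    d ∣ CompositionRing.trace (z * CompositionRing.conj u)) → ∃ z' : C, z = d • z'
  exists_idempotent : ∃ e : C, CompositionRing.nrm e = 0 ∧ CompositionRing.trace e = 1

namespace CompositionRing

/-- Here `ē = 1 - e` and `e ē = 0`, so `e² = e`. -/
theorem trace_mul_self_of_idempotent {C : Type} [CompositionRing C] {e : C} (h0 : nrm e = 0)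
    (h1 : trace e = 1) : trace (e * e) = 1 := by
  have h := add_conj e
  rw [h1, one_smul, add_comm] at h
  have h2 := trace_mul_conj_self e
  rw [eq_sub_of_add_eq h, h0, mul_sub, mul_one, map_sub, h1] at h2
  linarith

theorem IsSplit.exists_nrm_eq_neg_one {C : Type} [CompositionRing C] (hC : IsSplit C) :
    ∃ u : C, nrm u = -1 := by
  obtain ⟨e, h0, h1⟩ := hC.exists_idempotent
  -- The norm of `e - ē` is `n(e) + n(ē) - t(e²) = -1`.
  refine ⟨e + -conj e, ?_⟩
  rw [nrm_add, nrm_neg, nrm_conj, h0, map_neg, conj_conj, mul_neg, map_neg,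
    trace_mul_self_of_idempotent h0 h1]
  norm_num

theorem eq_zero_of_smul_eq_zero {C : Type} [CompositionRing C] {n : ℤ} (hn : n ≠ 0) {x : C}
    (h : n • x = 0) : x = 0 := by
  refine trace_nondegenerate x fun y => ?_
  have h1 : trace ((n • x) * conj y) = 0 := by rw [h, zero_mul, map_zero]
  rw [smul_mul_assoc, map_zsmul, smul_eq_mul] at h1
  exact (mul_eq_zero.mp h1).resolve_left hn

theorem isSplit_binarions : IsSplit Binarions where
  exists_eq_smul d z h := by
    obtain ⟨p, hp⟩ := h (1, 0) (0, 1) (by simp [nrm]) (by simp [trace, conj])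
    obtain ⟨q, hq⟩ := h (0, 1) (1, 0) (by simp [nrm]) (by simp [trace, conj])
    simp [trace, conj] at hp hq
    exact ⟨(q, p), by ext <;> simp [hp, hq]⟩
  exists_idempotent := ⟨(1, 0), by simp [nrm], by simp [trace]⟩

theorem quaternions_trace_mul_conj (w u : Quaternions) :
    trace (w * conj u) = w 0 0 * u 1 1 - w 0 1 * u 1 0 - w 1 0 * u 0 1 + w 1 1 * u 0 0 := by
  simp [trace, conj, Matrix.mul_apply, Fin.sum_univ_two]
  ring

theorem isSplit_quaternions : IsSplit Quaternions where
  exists_eq_smul d z h := by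
    simp only [quaternions_trace_mul_conj] at h
    -- The matrix units have norm zero, and up to sign each is dual to another one under the trace
    -- form.
    obtain ⟨p, hp⟩ := h !![1, 0; 0, 0] !![0, 0; 0, 1] (by simp [nrm]) (by simp)
    obtain ⟨q, hq⟩ := h !![0, 1; 0, 0] !![0, 0; -1, 0] (by simp [nrm]) (by simp)
    obtain ⟨r, hr⟩ := h !![0, 0; 1, 0] !![0, -1; 0, 0] (by simp [nrm]) (by simp)
    obtain ⟨s, hs⟩ := h !![0, 0; 0, 1] !![1, 0; 0, 0] (by simp [nrm]) (by simp)
    simp [neg_eq_iff_eq_neg] at hp hq hr hs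
    refine ⟨!![s, -r; -q, p], ?_⟩
    ext i j
    fin_cases i <;> fin_cases j <;> simp [hp, hq, hr, hs]
  exists_idempotent := ⟨!![1, 0; 0, 0], by simp [nrm], by simp [trace]⟩

/-- The two quaternion halves are orthogonal for the trace form, so divisibility can be tested on
each separately. -/
theorem isSplit_octonions : IsSplit Octonions where
  exists_eq_smul d z h := by
    obtain ⟨za, ha⟩ := isSplit_quaternions.exists_eq_smul d z.a fun u w hu hw => by
      have h1 := h ⟨u, 0⟩ ⟨w, 0⟩ (by simpa [nrm] using hu)
      simp [conj, trace] at h1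
      exact h1 hw
    obtain ⟨zb, hb⟩ := isSplit_quaternions.exists_eq_smul d z.b fun u w hu hw => by
      have e : ∀ w : Quaternions, trace (quatConj u * w) = trace (w * conj u) := fun w =>
        trace_mul_comm _ _
      have h1 := h ⟨0, u⟩ ⟨0, w⟩ (by simpa [nrm] using hu)
      simp only [conj, trace] at h1 e hw ⊢
      simp at h1 e hw ⊢
      rw [e, e] at h1
      exact h1 hw
    exact ⟨⟨za, zb⟩, Octonions.ext ha hb⟩
  exists_idempotent := ⟨⟨!![1, 0; 0, 0], 0⟩, by simp [nrm], by simp [trace]⟩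

theorem isSplit_splitRing : ∀ κ, IsSplit (SplitRing κ)
  | .binarions => isSplit_binarions
  | .quaternions => isSplit_quaternions
  | .octonions => isSplit_octonions

end CompositionRing

/-! ### Hermitian matrices with zero adjoint. -/

namespace Herm3

open CompositionRing

variable {C : Type} [CompositionRing C]

/-- The images of the matrices `diag t 0 0` under norm pairs generate all Hermitian matrices
additively. This extends the use of special translations to arbitrary matrices. -/
theorem induction_on_diag {P : Herm3 C → Prop} (hdiag : ∀ t, P (diag t 0 0))
    (hadd : ∀ A B, P A → P B → P (A + B))
    (hmap : ∀ s s' : Herm3 C ≃+ Herm3 C, IsNormPair s s' → ∀ A, P A → P (s A)) (A : Herm3 C) :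
    P A := by
  have hrot : ∀ A, P A → P (rotate A) := hmap _ _ IsNormPair.rotate
  have hb : ∀ t, P (diag 0 t 0) := fun t => hrot _ (hrot _ (hdiag t))
  have hc : ∀ t, P (diag 0 0 t) := fun t => hrot _ (hdiag t)
  have hz : ∀ u, P ⟨0, 0, 0, 0, 0, u⟩ := fun u => by
    -- The row operation sends `diag(1, 0, 0)` to a matrix with diagonal `1, n(u), 0` and
    -- off-diagonal entry `u`; the diagonal is then subtracted.
    have h := hadd _ _ (hadd _ _ (hmap _ _ (IsNormPair.rowAdd' u) _ (hdiag 1)) (hdiag (-1)))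
      (hb (-nrm u))
    convert h using 1
    ext1 <;> simp [rowAdd₂₁, diag]
  have hy : ∀ u, P ⟨0, 0, 0, 0, u, 0⟩ := fun u => hrot _ (hz u)
  have hx : ∀ u, P ⟨0, 0, 0, u, 0, 0⟩ := fun u => hrot _ (hy u)
  have h := hadd _ _ (hadd _ _ (hadd _ _ (hadd _ _ (hadd _ _ (hdiag A.a) (hb A.b)) (hc A.c))
    (hx A.x)) (hy A.y)) (hz A.z)
  convert h using 1
  ext1 <;> simp [diag]

theorem exists_eq_smul_of_dvd (hC : IsSplit C) {d : ℤ} {A : Herm3 C}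
    (h : ∀ B, NormEquivalent A B → d ∣ B.a) : ∃ A', A = d • A' := by
  have hz : ∀ D : Herm3 C, (∀ B, NormEquivalent D B → d ∣ B.a) → ∃ z', D.z = d • z' := fun D hD => by
    have ha : d ∣ D.a := hD _ (.refl D)
    have hb : d ∣ D.b := hD _ (.rotate D)
    -- A row operation by `u` changes the corner by `t(z ū) + b n(u)`, and `d` already divides `b`.
    refine hC.exists_eq_smul d _ fun u _ _ _ => ?_
    have h1 : d ∣ D.a + trace (D.z * conj u) + D.b * nrm u := hD _ (.rowAdd₁₂ u D)
    rwa [dvd_add_left (hb.mul_right _), dvd_add_right ha] at h1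
  have hrot := NormEquivalent.rotate A
  have hrot' := hrot.trans (.rotate _)
  obtain ⟨a, ha⟩ : d ∣ A.a := h _ (.refl A)
  obtain ⟨b, hb⟩ : d ∣ A.b := h _ hrot
  obtain ⟨c, hc⟩ : d ∣ A.c := h _ hrot'
  obtain ⟨z, hz0⟩ := hz _ h
  obtain ⟨x, hx⟩ := hz _ fun B hB => h _ (hrot.trans hB)
  obtain ⟨y, hy⟩ := hz _ fun B hB => h _ (hrot'.trans hB)
  exact ⟨⟨a, b, c, x, y, z⟩, Herm3.ext ha hb hc hx hy hz0⟩

theorem dvd_of_abs_le {m r : ℤ} (hm : m ≠ 0)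
    (h : ∀ k : ℤ, m + (r + m * k) ≠ 0 → |m| ≤ |m + (r + m * k)|) : m ∣ r := by
  by_contra hr
  -- This `k` makes the value the remainder of `r`, which is smaller than `|m|` and hence zero.
  have e : m + (r + m * (-(r / m) - 1)) = r % m := by
    rw [Int.emod_def]; ring
  have h1 := h (-(r / m) - 1)
  rw [e] at h1
  have h2 := h1 fun h0 => hr (Int.dvd_of_emod_eq_zero h0)
  rw [abs_of_nonneg (Int.emod_nonneg r hm)] at h2
  exact absurd (Int.emod_lt_abs r hm) (not_lt.mpr h2)

theorem exists_minimal {A : Herm3 C} (hC : IsSplit C) (h0 : A ≠ 0) :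
    ∃ B, NormEquivalent A B ∧ B.a ≠ 0 ∧ ∀ D, NormEquivalent A D → D.a ≠ 0 → |B.a| ≤ |D.a| := by
  classical
  have hex : ∃ n : ℕ, ∃ B, NormEquivalent A B ∧ B.a ≠ 0 ∧ B.a.natAbs = n := by
    by_contra hno
    push Not at hno
    -- With `d = 0` the divisibility criterion says that a matrix all of whose corners vanish is
    -- zero.
    obtain ⟨A', hA'⟩ := exists_eq_smul_of_dvd hC (d := 0) (A := A) fun B hB => by
      by_contra hB0
      exact hno _ B hB (fun h => hB0 (h ▸ dvd_rfl)) rfl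
    exact h0 (by simpa using hA')
  obtain ⟨B, hB, hB0, hBn⟩ := Nat.find_spec hex
  refine ⟨B, hB, hB0, fun D hD hD0 => ?_⟩
  have := Nat.find_min' hex ⟨D, hD, hD0, rfl⟩
  rw [Int.abs_eq_natAbs, Int.abs_eq_natAbs]
  omega

theorem NormEquivalent.diag_neg (hC : IsSplit C) (a : ℤ) :
    NormEquivalent (diag a 0 0 : Herm3 C) (diag (-a) 0 0) := by
  obtain ⟨u, hu⟩ := hC.exists_nrm_eq_neg_one
  -- With `n(u) = -1` the first operation creates `-a` in the second diagonal place, and the second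
  -- one clears both the corner and the off-diagonal entry.
  have h := ((rowAdd₂₁ u (diag a 0 0)).trans (rowAdd₁₂ u _)).trans (rotate _)
  convert h using 1
  ext1 <;> simp [Herm3.rowAdd₂₁, Herm3.rowAdd₁₂, Herm3.rotate, diag, hu, smul_mul_assoc,
    trace_mul_conj_self, -zsmul_eq_mul]
  ring

theorem exists_normEquivalent_diag (hC : IsSplit C) {A : Herm3 C} (hA : sharp A = 0)
    (h0 : A ≠ 0) : ∃ a, 0 < a ∧ NormEquivalent A (diag a 0 0) := by
  suffices h : ∃ a, a ≠ 0 ∧ NormEquivalent A (diag a 0 0) by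
    obtain ⟨a, ha, h⟩ := h
    rcases lt_or_gt_of_ne ha with ha | ha
    · exact ⟨-a, by omega, h.trans (.diag_neg hC a)⟩
    · exact ⟨a, ha, h⟩
  obtain ⟨⟨a, b, c, x, y, z⟩, hB, ha, hmin⟩ := exists_minimal hC h0
  simp only at ha hmin
  -- Adding `a k w` to `z` and then operating with `u` gives the corner `a + t(z ū) + a k`, because
  -- `t(w ū) = 1` and `n(u) = 0`. Minimality therefore forces `a ∣ t(z ū)`.
  obtain ⟨z, rfl⟩ := hC.exists_eq_smul a z fun u w hu hw => dvd_of_abs_le ha fun k hk => by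
    have h1 := hmin _ ((hB.trans (.rowAdd₂₁ (k • w) _)).trans (.rowAdd₁₂ u _))
    simp only [rowAdd₁₂, rowAdd₂₁, AddEquiv.coe_mk, Equiv.coe_fn_mk, add_mul, map_add,
      smul_mul_assoc, map_zsmul, smul_eq_mul, hu, hw, mul_zero, add_zero, mul_one] at h1
    exact h1 hk
  have hB1 := hB.trans (.rowAdd₂₁ (-z) _)
  have hs := hB1.sharp_eq_zero hA
  simp only [rowAdd₂₁, AddEquiv.coe_mk, Equiv.coe_fn_mk, smul_neg, add_neg_cancel] at hB1 hs
  set b' := b + trace (a • z * conj (-z)) + a * nrm (-z)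
  set x' := x + conj (-z) * conj y
  have hb' : b' = 0 := by
    -- With `z` cleared, the zero adjoint gives `a b' = 0` and `a x' = 0`.
    have h1 := congrArg Herm3.c hs
    simp only [sharp, nrm_zero, sub_zero] at h1
    exact (mul_eq_zero.mp h1).resolve_left ha
  have hx' : x' = 0 := by
    have h1 := congrArg Herm3.x hs
    simp only [sharp, map_zero, zero_mul, zero_sub] at h1
    exact eq_zero_of_smul_eq_zero ha (neg_eq_zero.mp h1)
  rw [hb', hx'] at hB1
  -- After two rotations `y` is in the place of `z` and `a` in the second diagonal place, so the
  -- argument repeats with the two row operations swapped.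
  have hB2 := (hB1.trans (.rotate _)).trans (.rotate _)
  simp only [rotate, AddEquiv.coe_mk, Equiv.coe_fn_mk] at hB2
  obtain ⟨y, rfl⟩ := hC.exists_eq_smul a y fun u w hu hw => dvd_of_abs_le ha fun k hk => by
    have h1 := hmin _ (((hB2.trans (.rowAdd₁₂ (k • w) _)).trans (.rowAdd₂₁ u _)).trans
      (.rotate _))
    simp only [rowAdd₁₂, rowAdd₂₁, rotate, AddEquiv.coe_mk, Equiv.coe_fn_mk, add_mul, map_add,
      smul_mul_assoc, map_zsmul, smul_eq_mul, hu, hw, mul_zero, add_zero, mul_one] at h1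
    exact h1 hk
  have hB3 := (hB2.trans (.rowAdd₁₂ (-y) _)).trans (.rotate _)
  have hs := hB3.sharp_eq_zero hA
  simp only [rowAdd₁₂, rotate, AddEquiv.coe_mk, Equiv.coe_fn_mk, smul_neg, add_neg_cancel,
    map_zero, zero_mul, add_zero] at hB3 hs
  have h1 := congrArg Herm3.b hs
  simp only [sharp, nrm_zero, sub_zero] at h1
  rw [(mul_eq_zero.mp h1).resolve_left ha] at hB3
  exact ⟨a, ha, hB3⟩

end Herm3

namespace FreudenthalModule

open CompositionRing Herm3

variable {C : Type} [CompositionRing C]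

@[simp] theorem smul_α (n : ℤ) (x : FreudenthalModule C) : (n • x).α = n * x.α := rfl
@[simp] theorem smul_β (n : ℤ) (x : FreudenthalModule C) : (n • x).β = n * x.β := rfl
@[simp] theorem smul_A (n : ℤ) (x : FreudenthalModule C) : (n • x).A = n • x.A := rfl
@[simp] theorem smul_B (n : ℤ) (x : FreudenthalModule C) : (n • x).B = n • x.B := rfl
@[simp] theorem zero_α : (0 : FreudenthalModule C).α = 0 := rfl
@[simp] theorem zero_β : (0 : FreudenthalModule C).β = 0 := rfl
@[simp] theorem zero_A : (0 : FreudenthalModule C).A = 0 := rfl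
@[simp] theorem zero_B : (0 : FreudenthalModule C).B = 0 := rfl

/-! ### Reduction -/

theorem exists_eq_smul_of_dvd (hC : IsSplit C) {d : ℤ} {x : FreudenthalModule C}
    (h : ∀ y, Equivalent x y → d ∣ y.α) : ∃ x', x = d • x' := by
  have hB : ∀ α β A B, Equivalent x ⟨α, β, A, B⟩ → ∃ B', B = d • B' := fun α β A B hx =>
    Herm3.exists_eq_smul_of_dvd hC fun D ⟨s, s', hs, hD⟩ => by
      have h1 := hx.trans (.of_isNormPair hs.dual α β A B)
      -- Translation by one adds the corner of the last component to the first coordinate, and norm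
      -- pairs put any corner of the orbit there.
      have h2 : d ∣ α + 1 * (s B).a := h _ (h1.trans (.translate 1 _ _ _ _))
      rwa [dvd_add_right (h _ h1 : d ∣ α), one_mul, hD] at h2
  have hτ := Equivalent.exchange x.α x.β x.A x.B
  obtain ⟨α, hα⟩ : d ∣ x.α := h _ (.refl x)
  obtain ⟨β, hβ⟩ : d ∣ x.β := (dvd_neg.mp (h _ hτ) : d ∣ x.β)
  obtain ⟨B, hB0⟩ := hB x.α x.β x.A x.B (.refl x)
  obtain ⟨A, hA⟩ := hB _ _ _ _ hτ
  exact ⟨⟨α, β, A, B⟩, FreudenthalModule.ext hα hβ hA hB0⟩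

/-- A multiple of `α` can be added to the last component, changing the third one by a
multiple of `α` only. -/
theorem exists_equivalent_add (α : ℤ) (D : Herm3 C) : ∀ (β : ℤ) (A B : Herm3 C),
    (∃ B', B = α • B') → ∃ (β' : ℤ) (A' : Herm3 C),
      Equivalent ⟨α, β, A, B⟩ ⟨α, β', A + α • A', B + α • D⟩ := by
  induction D using induction_on_diag with
  | hdiag t =>
    rintro β A _ ⟨B, rfl⟩
    -- The change in `A` is linear in the last component, hence a multiple of `α`.
    refine ⟨β + t * A.a, ⟨0, t * B.c, t * B.b, -(t • B.x), 0, 0⟩, ?_⟩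
    convert Equivalent.translate' t α β A (α • B) using 2
    · ext1 <;> simp [-zsmul_eq_mul] <;> first | ring | module
    · ext1 <;> simp [diag, -zsmul_eq_mul]
      ring
  | hadd D E hD hE =>
    rintro β A _ ⟨B, rfl⟩
    obtain ⟨β₁, A₁, h₁⟩ := hD β A _ ⟨B, rfl⟩
    obtain ⟨β₂, A₂, h₂⟩ := hE β₁ (A + α • A₁) (α • B + α • D) ⟨B + D, (smul_add _ _ _).symm⟩
    refine ⟨β₂, A₁ + A₂, ?_⟩
    convert h₁.trans h₂ using 2 <;> module
  | hmap s s' hs D hD =>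
    rintro β A _ ⟨B, rfl⟩
    obtain ⟨β', A', h⟩ := hD β (s'.symm A) _ ⟨s.symm B, rfl⟩
    refine ⟨β', s' A', ?_⟩
    have h1 := Equivalent.of_isNormPair hs.symm.dual α β A (α • B)
    rw [map_zsmul s.symm] at h1
    have h2 := (h1.trans h).trans (.of_isNormPair hs.dual _ _ _ _)
    simpa [-zsmul_eq_mul] using h2

/-- Entries of `A` appear in the last component, so divisibility known for last components passes to
`A`. -/
theorem Equivalent.translate_one (α β : ℤ) (A : Herm3 C) : Equivalent ⟨α, β, A, 0⟩
    ⟨α, β, ⟨A.a + β, A.b, A.c, A.x, A.y, A.z⟩, ⟨0, A.c, A.b, -A.x, 0, 0⟩⟩ := by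
  simpa using translate 1 α β A 0

theorem exists_minimal (hC : IsSplit C) {x : FreudenthalModule C} (hx : x ≠ 0) :
    ∃ y, Equivalent x y ∧ 0 < y.α ∧ ∀ z, Equivalent x z → 0 < z.α → y.α ≤ z.α := by
  classical
  have hex : ∃ n : ℕ, ∃ y, Equivalent x y ∧ 0 < y.α ∧ y.α.toNat = n := by
    by_contra hno
    push Not at hno
    obtain ⟨x', hx'⟩ := exists_eq_smul_of_dvd hC (d := 0) (x := x) fun y hy => by
      rcases lt_trichotomy y.α 0 with h | h | h
      · exact absurd rfl (hno _ (-y) (hy.trans (.neg y)) (neg_pos.mpr h : 0 < -y.α))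
      · rw [h]
      · exact absurd rfl (hno _ y hy h)
    exact hx (by simpa using hx')
  obtain ⟨y, hy, hy0, hyn⟩ := Nat.find_spec hex
  refine ⟨y, hy, hy0, fun z hz hz0 => ?_⟩
  have := Nat.find_min' hex ⟨z, hz, hz0, rfl⟩
  omega

/-- Every nonzero element is equivalent to a reduced one. -/
theorem exists_reduced (hC : IsSplit C) {x : FreudenthalModule C} (hx : x ≠ 0) :
    ∃ (α β : ℤ) (A : Herm3 C), 0 < α ∧ Equivalent x ⟨α, α * β, α • A, 0⟩ := by
  obtain ⟨⟨α, β, A, B⟩, hxy, hα, hmin⟩ := exists_minimal hC hx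
  simp only at hα hmin
  have hBa : ∀ β A B, Equivalent x ⟨α, β, A, B⟩ → α ∣ B.a := fun β A B h => by
    have h1 := (h.trans (.translate' (-(B.a / α)) _ _ _ _)).trans (.translate (-1) _ _ _ _)
    have h2 := hmin _ h1
    -- This value lies between `1` and `α`, so minimality of `α` makes the remainder zero.
    have e : α + -1 * (B.a + -(B.a / α) * α) = α - B.a % α := by
      rw [Int.emod_def]; ring
    simp only [e] at h2
    have h3 := Int.emod_nonneg B.a hα.ne'
    have h4 := Int.emod_lt_of_pos B.a hα
    exact Int.dvd_of_emod_eq_zero (by linarith [h2 (by linarith)])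
  have hB : ∀ β A B, Equivalent x ⟨α, β, A, B⟩ → ∃ B', B = α • B' := fun β A B h =>
    Herm3.exists_eq_smul_of_dvd hC fun D ⟨s, s', hs, hD⟩ => by
      rw [← hD]
      exact hBa _ _ _ (h.trans (.of_isNormPair hs.dual α β A B))
  have hclear : ∀ β A B, Equivalent x ⟨α, β, A, B⟩ →
      ∃ β' A', Equivalent x ⟨α, β', A + α • A', 0⟩ := fun β A B h => by
    obtain ⟨B', rfl⟩ := hB β A B h
    obtain ⟨β', A', h'⟩ := exists_equivalent_add α (-B') β A (α • B') ⟨B', rfl⟩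
    rw [smul_neg, add_neg_cancel] at h'
    exact ⟨β', A', h.trans h'⟩
  have hA₀ : ∀ β A, Equivalent x ⟨α, β, A, 0⟩ → α ∣ A.b ∧ ∃ x', A.x = α • x' :=
      fun β A h => by
    obtain ⟨B', hB'⟩ := hB _ _ _ (h.trans (.translate_one _ _ _))
    refine ⟨⟨B'.c, congrArg Herm3.c hB'⟩, -B'.x, ?_⟩
    rw [smul_neg, ← neg_eq_iff_eq_neg]
    exact congrArg Herm3.x hB'
  have hA : ∀ β A, Equivalent x ⟨α, β, A, 0⟩ → ∃ A', A = α • A' := fun β A h => by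
    have h1 := h.trans (.of_normEquivalent (.rotate _) _ _)
    have h2 := h1.trans (.of_normEquivalent (.rotate _) _ _)
    obtain ⟨⟨b, hb⟩, u, hu⟩ := hA₀ _ _ h
    obtain ⟨⟨c, hc⟩, v, hv⟩ := hA₀ _ _ h1
    obtain ⟨⟨a, ha⟩, w, hw⟩ := hA₀ _ _ h2
    exact ⟨⟨a, b, c, u, v, w⟩, Herm3.ext ha hb hc hu hv hw⟩
  obtain ⟨β, A, h⟩ := hclear β A B hxy
  obtain ⟨A', hA'⟩ := hA β _ h
  have hβ : α ∣ β := by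
    -- The translation adds `β` to the corner of `A`, and clearing changes that corner only by
    -- multiples of `α`. Both the old and the final corner are divisible by `α`.
    obtain ⟨β₁, A₁, h₁⟩ := hclear _ _ _ (h.trans (.translate_one _ _ _))
    obtain ⟨A₂, hA₂⟩ := hA _ _ h₁
    have e := congrArg Herm3.a hA₂
    rw [hA'] at e
    simp only [add_a', smul_a'] at e
    exact ⟨A₂.a - A₁.a - A'.a, by linarith⟩
  obtain ⟨β', rfl⟩ := hβ
  exact ⟨α, β', A', hα, by rwa [hA'] at h⟩

/-! ### Invariants -/

theorem gcdOf_eq {V : Type} [AddCommGroup V] {S : Set V} {n : ℤ} (hn : 0 < n)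
    (h : ∀ d : ℤ, (∀ v ∈ S, ∃ v' : V, v = d • v') ↔ d ∣ n) : gcdOf S = n := by
  simp only [gcdOf, h]
  exact IsGreatest.csSup_eq ⟨dvd_rfl, fun d hd => Int.le_of_dvd hn hd⟩

theorem gcdOf_image {V : Type} [AddCommGroup V] (g : V ≃ₗ[ℤ] V) (S : Set V) :
    gcdOf (g '' S) = gcdOf S := by
  have h : ∀ (d : ℤ) (v : V), (∃ v', g v = d • v') ↔ ∃ v', v = d • v' := fun d v =>
    ⟨fun ⟨v', hv⟩ => ⟨g.symm v', by rw [← map_zsmul, ← hv, g.symm_apply_apply]⟩,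
      fun ⟨v', hv⟩ => ⟨g v', by rw [hv, map_zsmul]⟩⟩
  simp only [gcdOf, Set.forall_mem_image, h]

/-- Nondegeneracy lets `T` be recovered from the polarized quartic form and the symplectic form,
both preserved by `g`. -/
theorem tripleTLin_map {g : FreudenthalModule C ≃ₗ[ℤ] FreudenthalModule C} (hg : g ∈ autGroup C)
    (x y : FreudenthalModule C) : tripleTLin (g x) (g y) = g (tripleTLin x y) := by
  refine symp_left_injective fun w => ?_
  obtain ⟨w, rfl⟩ := g.surjective w
  have h1 := tripleTLin_spec (g x) (g y) (g w)
  have h2 := tripleTLin_spec x y w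
  simp only [polar4, ← map_add, hg.2] at h1
  rw [hg.1]
  rw [polar4] at h2
  linarith

theorem tripleT_map {g : FreudenthalModule C ≃ₗ[ℤ] FreudenthalModule C} (hg : g ∈ autGroup C)
    (x : FreudenthalModule C) : tripleT (g x) = g (tripleT x) := by
  refine symp_left_injective fun w => ?_
  obtain ⟨w, rfl⟩ := g.surjective w
  have h1 := tripleT_spec (g x) (g w)
  have h2 := tripleT_spec x w
  simp only [polar4, ← map_add, hg.2] at h1
  rw [hg.1]
  rw [polar4] at h2
  linarith

theorem tripleTLin_add_map {g : FreudenthalModule C ≃ₗ[ℤ] FreudenthalModule C}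
    (hg : g ∈ autGroup C) (x y : FreudenthalModule C) :
    tripleTLin (g x) (g y) + symp (g x) (g y) • g x = g (tripleTLin x y + symp x y • x) := by
  rw [tripleTLin_map hg, hg.1, map_add, map_zsmul]

namespace Equivalent

variable {x y : FreudenthalModule C}

theorem d₁_eq (h : Equivalent x y) : y.d₁ = x.d₁ := by
  obtain ⟨g, hg, rfl⟩ := h
  rw [d₁, ← Set.image_singleton, gcdOf_image, d₁]

theorem d₂_eq (h : Equivalent x y) : y.d₂ = x.d₂ := by
  obtain ⟨g, hg, rfl⟩ := h
  rw [d₂, d₂, ← gcdOf_image g (Set.range fun y => tripleTLin x y + symp x y • x),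
    ← Set.range_comp, ← g.surjective.range_comp]
  congr 2
  funext y
  exact tripleTLin_add_map hg x y

theorem rank_eq (h : Equivalent x y) : y.rank = x.rank := by
  obtain ⟨g, hg, rfl⟩ := h
  have h1 : (∀ y, tripleTLin (g x) y + symp (g x) y • g x = 0) ↔
      ∀ y, tripleTLin x y + symp x y • x = 0 := by
    rw [g.surjective.forall]
    simp only [tripleTLin_add_map hg, map_eq_zero_iff g g.injective]
  have h2 : g x = 0 ↔ x = 0 := map_eq_zero_iff g g.injective
  have h3 : tripleT (g x) = 0 ↔ tripleT x = 0 := by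
    rw [tripleT_map hg, map_eq_zero_iff g g.injective]
  unfold rank
  rw [propext h1, propext h2, propext h3, hg.2]

end Equivalent

theorem rank_eq_one_iff {x : FreudenthalModule C} :
    x.rank = 1 ↔ x ≠ 0 ∧ ∀ y, tripleTLin x y + symp x y • x = 0 := by
  unfold rank
  split_ifs with h1 h2 h3 h4 <;> simp_all

theorem rank_eq_two_iff {x : FreudenthalModule C} :
    x.rank = 2 ↔ x ≠ 0 ∧ (¬ ∀ y, tripleTLin x y + symp x y • x = 0) ∧ tripleT x = 0 := by
  unfold rank
  split_ifs with h1 h2 h3 h4 <;> simp_all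

theorem d₁_eq_of_reduced {α : ℤ} (hα : 0 < α) (β : ℤ) (A : Herm3 C) :
    d₁ ⟨α, α * β, α • A, 0⟩ = α := by
  refine gcdOf_eq hα fun d => ?_
  simp only [Set.mem_singleton_iff, forall_eq]
  refine ⟨fun ⟨v, hv⟩ => ⟨v.α, congrArg FreudenthalModule.α hv⟩, ?_⟩
  rintro ⟨c, rfl⟩
  exact ⟨⟨c, c * β, c • A, 0⟩, by ext1 <;> simp [mul_assoc, mul_smul, -zsmul_eq_mul]⟩

theorem bil_zero_right (A : Herm3 C) : bil A 0 = 0 := by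
  simpa using bil_smul 0 A A

theorem bil_zero_left (A : Herm3 C) : bil 0 A = 0 := by
  rw [bil_symm, bil_zero_right]

theorem sharp_zero : sharp (0 : Herm3 C) = 0 := by
  simpa using sharp_smul 0 (0 : Herm3 C)

theorem det_zero : det (0 : Herm3 C) = 0 := by
  simpa using det_smul 0 (0 : Herm3 C)

theorem cross_zero_right (A : Herm3 C) : cross A 0 = 0 := by
  simpa using cross_smul 0 A A

theorem cross_zero_left (A : Herm3 C) : cross 0 A = 0 := by
  rw [cross_comm, cross_zero_right]

theorem bil_diag (a b c : ℤ) (A : Herm3 C) :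
    bil (diag a b c) A = a * A.a + b * A.b + c * A.c := by
  simp [bil, diag]

theorem sharp_diag (a b c : ℤ) :
    sharp (diag a b c : Herm3 C) = diag (b * c) (a * c) (a * b) := by
  ext1 <;> simp [sharp, diag, nrm_zero]

theorem det_diag (a b c : ℤ) : det (diag a b c : Herm3 C) = a * b * c := by
  simp [det, diag, nrm_zero]

theorem smul_diag (n a b c : ℤ) :
    n • (diag a b c : Herm3 C) = diag (n * a) (n * b) (n * c) := by
  ext1 <;> simp [diag, -zsmul_eq_mul]

theorem diag_zero : (diag 0 0 0 : Herm3 C) = 0 := rfl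

/-! ### Elements of rank one and two -/

/-- The first coordinate alone already detects both `β` and `A`, by varying `y`. -/
theorem tripleTLin_add_of_right_eq_zero (α β : ℤ) (A : Herm3 C) (y : FreudenthalModule C) :
    (tripleTLin ⟨α, β, A, 0⟩ y + symp ⟨α, β, A, 0⟩ y • (⟨α, β, A, 0⟩ : FreudenthalModule C)).α =
      -3 * α * β * y.α + 2 * α * bil A y.B := by
  simp only [tripleTLin, symp, add_α, smul_α, bil_zero_left, bil_zero_right, sharp_zero]
  ring

theorem exists_rank_one (hC : IsSplit C) {x : FreudenthalModule C} (hx : x.rank = 1) :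
    1 ≤ x.d₁ ∧ x.Equivalent ⟨x.d₁, 0, 0, 0⟩ := by
  obtain ⟨α, β, A, hα, h⟩ := exists_reduced hC (rank_eq_one_iff.mp hx).1
  have hd : x.d₁ = α := by rw [← h.d₁_eq, d₁_eq_of_reduced hα]
  have h1 := (rank_eq_one_iff.mp (h.rank_eq.trans hx)).2
  have h2 : ∀ y : FreudenthalModule C,
      -3 * α * (α * β) * y.α + 2 * α * bil (α • A) y.B = 0 := fun y => by
    rw [← tripleTLin_add_of_right_eq_zero, h1 y]; rfl
  have hβ : α * β = 0 := by
    have h3 := h2 ⟨1, 0, 0, 0⟩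
    rw [bil_zero_right] at h3
    have h4 : α * (α * β) = 0 := by linarith
    exact (mul_eq_zero.mp h4).resolve_left hα.ne'
  have hA : α • A = 0 := bil_nondegenerate _ fun E => by
    have h3 := h2 ⟨0, 0, 0, E⟩
    have h4 : α * bil (α • A) E = 0 := by linarith
    exact (mul_eq_zero.mp h4).resolve_left hα.ne'
  rw [hβ, hA] at h
  rw [hd]
  exact ⟨hα, h⟩

theorem d₁_rank_one {k : ℤ} (hk : 1 ≤ k) : d₁ (⟨k, 0, 0, 0⟩ : FreudenthalModule C) = k := by
  simpa using d₁_eq_of_reduced (C := C) hk 0 0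

theorem rank_eq_one {k : ℤ} (hk : 1 ≤ k) : (⟨k, 0, 0, 0⟩ : FreudenthalModule C).rank = 1 := by
  refine rank_eq_one_iff.mpr ⟨fun h => ?_, fun y => ?_⟩
  · have := congrArg FreudenthalModule.α h
    simp only [zero_α] at this
    omega
  · ext1
    · rw [tripleTLin_add_of_right_eq_zero, bil_zero_left]
      simp
    all_goals simp [tripleTLin, symp, bil_zero_left, bil_zero_right, sharp_zero, cross_zero_left,
        cross_zero_right]

/-- The vector multiplied by `2 k m` can have first coordinate `1`, so the greatest common divisor
is exactly `2 k m`. -/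
theorem tripleTLin_add_rank_two (k m : ℤ) (y : FreudenthalModule C) :
    tripleTLin ⟨k, 0, diag m 0 0, 0⟩ y + symp ⟨k, 0, diag m 0 0, 0⟩ y •
      (⟨k, 0, diag m 0 0, 0⟩ : FreudenthalModule C) =
      (2 * k * m) • ⟨y.B.a, 0, diag y.β 0 0, cross (diag 1 0 0) y.A⟩ := by
  have h : cross (diag m 0 0) y.A = m • cross (diag 1 0 0 : Herm3 C) y.A := by
    rw [cross_comm, cross_comm _ y.A, ← cross_smul, smul_diag, mul_one, mul_zero]
  ext1
  · rw [tripleTLin_add_of_right_eq_zero, bil_diag]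
    simp
    ring
  · simp [tripleTLin, symp, bil_zero_left, bil_zero_right, sharp_diag, diag_zero]
  · simp [tripleTLin, symp, bil_zero_left, bil_zero_right, sharp_diag, sharp_zero, diag_zero,
      cross_zero_left, cross_zero_right, bil_diag, smul_diag, -zsmul_eq_mul]
    ext1 <;> simp [diag]
    ring
  · simp [tripleTLin, symp, bil_zero_left, bil_zero_right, sharp_diag, sharp_zero, diag_zero,
      cross_zero_left, cross_zero_right, bil_diag, smul_diag, -zsmul_eq_mul, h, smul_smul]

theorem d₂_rank_two {k m : ℤ} (hk : 0 < k) (hm : 0 < m) :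
    d₂ (⟨k, 0, diag m 0 0, 0⟩ : FreudenthalModule C) = 2 * k * m := by
  refine gcdOf_eq (by positivity) fun d => ?_
  simp only [Set.forall_mem_range, tripleTLin_add_rank_two]
  refine ⟨fun h => ?_, ?_⟩
  · obtain ⟨v, hv⟩ := h ⟨0, 0, 0, diag 1 0 0⟩
    have h1 := congrArg FreudenthalModule.α hv
    exact ⟨v.α, by simpa [diag] using h1⟩
  · rintro ⟨c, hc⟩ y
    exact ⟨_, by rw [hc, mul_smul]⟩

theorem d₁_rank_two {k m : ℤ} (hk : 0 < k) (hm : k ∣ m) :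
    d₁ (⟨k, 0, diag m 0 0, 0⟩ : FreudenthalModule C) = k := by
  obtain ⟨n, rfl⟩ := hm
  simpa [smul_diag] using d₁_eq_of_reduced (C := C) hk 0 (diag n 0 0)

theorem rank_eq_two {k m : ℤ} (hk : 0 < k) (hm : 0 < m) :
    (⟨k, 0, diag m 0 0, 0⟩ : FreudenthalModule C).rank = 2 := by
  refine rank_eq_two_iff.mpr ⟨fun h => ?_, fun h => ?_, ?_⟩
  · have := congrArg FreudenthalModule.α h
    simp only [zero_α] at this
    omega
  · have h1 := congrArg FreudenthalModule.α (h ⟨0, 0, 0, diag 1 0 0⟩)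
    rw [tripleTLin_add_rank_two] at h1
    simp [diag] at h1
    omega
  · ext1 <;> simp [tripleT, bil_zero_right, sharp_diag, sharp_zero, diag_zero,
      cross_zero_right, det_zero, det_diag]

theorem exists_rank_two (hC : IsSplit C) {x : FreudenthalModule C} (hx : x.rank = 2) :
    ∃ a : ℤ, 0 < x.d₁ ∧ 0 < a ∧ x.d₁ ∣ a ∧ 2 * x.d₁ * a = x.d₂ ∧
      x.Equivalent ⟨x.d₁, 0, diag a 0 0, 0⟩ := by
  obtain ⟨α, β, A, hα, h⟩ := exists_reduced hC (rank_eq_two_iff.mp hx).1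
  have hd : x.d₁ = α := by rw [← h.d₁_eq, d₁_eq_of_reduced hα]
  obtain ⟨h0, h1, h2⟩ := rank_eq_two_iff.mp (h.rank_eq.trans hx)
  have hβ : β = 0 := by
    have h3 := congrArg FreudenthalModule.α h2
    simp [tripleT, bil_zero_right, det_zero] at h3
    omega
  subst hβ
  -- The last component of `T` at the reduced element is `2 α³ A^#`.
  have hsharp : sharp A = 0 := by
    have h3 := congrArg FreudenthalModule.B h2
    simp [tripleT, bil_zero_right, sharp_zero, cross_zero_right, sharp_smul,
      -zsmul_eq_mul, smul_smul] at h3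
    refine bil_nondegenerate _ fun E => ?_
    have h4 : bil ((2 * α * α ^ 2) • sharp A) E = 0 := by rw [h3, bil_zero_left]
    rw [bil_smul_left] at h4
    exact (mul_eq_zero.mp h4).resolve_left (by positivity)
  have hA : A ≠ 0 := by
    rintro rfl
    have h3 := (rank_eq_one_iff.mp (rank_eq_one (C := C) hα)).2
    simp only [smul_zero, mul_zero] at h1
    exact h1 h3
  obtain ⟨a, ha, s, s', hs, hA'⟩ := exists_normEquivalent_diag hC hsharp hA
  have h3 := h.trans (.of_normEquivalent ⟨s, s', hs, rfl⟩ _ _)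
  rw [map_zsmul, hA', smul_diag, mul_zero] at h3
  refine ⟨α * a, hd ▸ hα, by positivity, hd ▸ dvd_mul_right _ _, ?_, hd ▸ h3⟩
  rw [← h3.d₂_eq, d₂_rank_two hα (by positivity), hd]

end FreudenthalModule

/-! ### Merging coprime diagonal entries. -/

namespace Herm3

open CompositionRing

variable {C : Type} [CompositionRing C]

theorem NormEquivalent.diag_of_isCoprime (hC : IsSplit C) {a b : ℤ} (h : IsCoprime a b) (c : ℤ) :
    NormEquivalent (diag a b c : Herm3 C) (diag 1 (a * b) c) := by
  obtain ⟨e, h0, h1⟩ := hC.exists_idempotent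
  obtain ⟨r, s, hrs⟩ := h
  have hee := trace_mul_self_of_idempotent h0 h1
  have hn : nrm (e + (b * (1 - a)) • conj e) = b * (1 - a) := by
    rw [nrm_add, nrm_smul, nrm_conj, h0, map_zsmul, conj_conj, mul_smul_comm, map_zsmul, hee]
    simp
  -- Since `r a + s b = 1` and `n(e) = 0`, the first two operations only put `e` off the diagonal.
  -- The third raises the corner by `(1 - a) t(e²)` to `1`. The last clears the off-diagonal entry,
  -- of norm `b (1 - a)`, and leaves `b - b (1 - a) = a b`.
  have key := (((rowAdd₂₁ (r • e) (diag a b c)).trans (rowAdd₁₂ (s • e) _)).trans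
    (rowAdd₁₂ ((1 - a) • conj e) _)).trans (rowAdd₂₁ (-(e + (b * (1 - a)) • conj e)) _)
  have hz : (a * r) • e + (b * s) • e = e := by
    rw [← add_smul, show a * r + b * s = 1 by linarith, one_smul]
  simp only [Herm3.rowAdd₂₁, Herm3.rowAdd₁₂, diag, AddEquiv.coe_mk, Equiv.coe_fn_mk, zero_mul,
    mul_zero, map_zero, add_zero, zero_add, nrm_smul, h0, smul_smul, smul_mul_assoc, map_zsmul,
    mul_smul_comm, trace_mul_conj_self, smul_zero, hz, nrm_conj, conj_conj, hee, smul_eq_mul,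
    mul_one, nrm_neg, hn, map_neg, mul_neg, add_sub_cancel, one_smul, add_neg_cancel, one_mul] at key
  convert key using 1 <;> ext1 <;> simp only [diag]
  ring

theorem NormEquivalent.diag_of_pairwise (hC : IsSplit C) {a b c : ℤ} (hab : IsCoprime a b)
    (hac : IsCoprime a c) (hbc : IsCoprime b c) :
    NormEquivalent (diag a b c : Herm3 C) (diag (a * b * c) 1 1) := by
  have h1 := (NormEquivalent.diag_of_isCoprime (C := C) hC hab c).trans (rotate _)
  have h2 := h1.trans (diag_of_isCoprime hC (hac.mul_left hbc) 1)
  exact h2.trans (rotate _)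

end Herm3

theorem Int.exists_isCoprime_add_mul {a b m : ℤ} (hm : m ≠ 0)
    (h : ∀ p : ℕ, p.Prime → (p : ℤ) ∣ a → (p : ℤ) ∣ b → ¬ (p : ℤ) ∣ m) :
    ∃ t : ℤ, IsCoprime (a + t * b) m := by
  classical
  -- For a prime `p` dividing `m`, exactly one of `a` and `t` is divisible by `p`; if it is `a`,
  -- then `p` does not divide `b`.
  set t : ℕ := ∏ p ∈ m.natAbs.primeFactors.filter fun p : ℕ => ¬ (p : ℤ) ∣ a, p
  refine ⟨t, ?_⟩
  rw [Int.isCoprime_iff_gcd_eq_one]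
  by_contra hg
  obtain ⟨p, hp, hpg⟩ := Nat.exists_prime_and_dvd hg
  have hpg' : (p : ℤ) ∣ (Int.gcd (a + t * b) m : ℤ) := by exact_mod_cast hpg
  have h1 : (p : ℤ) ∣ a + t * b := hpg'.trans (Int.gcd_dvd_left ..)
  have h2 : (p : ℤ) ∣ m := hpg'.trans (Int.gcd_dvd_right ..)
  by_cases hpa : (p : ℤ) ∣ a
  · rcases (Nat.prime_iff_prime_int.mp hp).dvd_or_dvd ((dvd_add_right hpa).mp h1) with h3 | h3
    · have h4 : p ∣ t := by exact_mod_cast h3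
      obtain ⟨q, hq, hpq⟩ := (hp.prime.dvd_finsetProd_iff _).mp h4
      rw [Finset.mem_filter, Nat.mem_primeFactors] at hq
      rw [(Nat.prime_dvd_prime_iff_eq hp hq.1.1).mp hpq] at hpa
      exact hq.2 hpa
    · exact h p hp hpa h3 h2
  · have h3 : p ∣ t := Finset.dvd_prod_of_mem (fun p => p) (by
      rw [Finset.mem_filter, Nat.mem_primeFactors]
      exact ⟨⟨hp, Int.natCast_dvd.mp h2, by simpa using hm⟩, hpa⟩)
    have h4 : (p : ℤ) ∣ t := by exact_mod_cast h3
    exact hpa ((dvd_add_left (h4.mul_right b)).mp h1)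

/-! ### Projective elements. -/

namespace FreudenthalModule

open CompositionRing Herm3

variable {C : Type} [CompositionRing C]

namespace Equivalent

theorem translate_diag (t α β a₁ a₂ a₃ b₁ b₂ b₃ : ℤ) :
    Equivalent (⟨α, β, diag a₁ a₂ a₃, diag b₁ b₂ b₃⟩ : FreudenthalModule C)
      ⟨α + t * b₁, β, diag (a₁ + t * β) a₂ a₃, diag b₁ (b₂ + t * a₃) (b₃ + t * a₂)⟩ := by
  simpa [diag] using translate (C := C) t α β (diag a₁ a₂ a₃) (diag b₁ b₂ b₃)

theorem translate'_diag (t α β a₁ a₂ a₃ b₁ b₂ b₃ : ℤ) :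
    Equivalent (⟨α, β, diag a₁ a₂ a₃, diag b₁ b₂ b₃⟩ : FreudenthalModule C)
      ⟨α, β + t * a₁, diag a₁ (a₂ + t * b₃) (a₃ + t * b₂), diag (b₁ + t * α) b₂ b₃⟩ := by
  simpa [diag] using translate' (C := C) t α β (diag a₁ a₂ a₃) (diag b₁ b₂ b₃)

theorem rotate_diag (α β a₁ a₂ a₃ b₁ b₂ b₃ : ℤ) :
    Equivalent (⟨α, β, diag a₁ a₂ a₃, diag b₁ b₂ b₃⟩ : FreudenthalModule C)
      ⟨α, β, diag a₂ a₃ a₁, diag b₂ b₃ b₁⟩ :=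
  of_isNormPair IsNormPair.rotate _ _ _ _

theorem rotate_diag_zero (α β a b c : ℤ) :
    Equivalent (⟨α, β, diag a b c, 0⟩ : FreudenthalModule C) ⟨α, β, diag b c a, 0⟩ :=
  rotate_diag α β a b c 0 0 0

/-- The change of variables `X ↦ X + t Y` in the binary quadratic form `a, β, -b c`. -/
theorem shift (t β a b c : ℤ) :
    Equivalent (⟨1, β, diag a b c, 0⟩ : FreudenthalModule C)
      ⟨1, β - 2 * t * (b * c), diag (a + t * β - t ^ 2 * (b * c)) b c, 0⟩ := by
  -- The translation creates `t c` and `t b` in the last component; since `α = 1`, two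
  -- contragredient translations, in rotated positions, remove them.
  have h1 := translate_diag (C := C) t 1 β a b c 0 0 0
  have h2 := h1.trans (rotate_diag ..)
  have h3 := h2.trans (translate'_diag (-(t * c)) ..)
  have h4 := h3.trans (rotate_diag ..)
  have h5 := h4.trans (translate'_diag (-(t * b)) ..)
  have h6 := h5.trans (rotate_diag ..)
  rw [diag_zero] at h6
  convert h6 using 2
  · ring
  · ring
  · congr 1 <;> ring
  · rw [← diag_zero]
    congr 1 <;> ring

end Equivalent

/-- No prime divisor of `β` divides two of `a`, `b`, `c`. -/
def CoprimeAt (β a b c : ℤ) : Prop :=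
  ∀ p : ℕ, p.Prime → (p : ℤ) ∣ β →
    ¬ ((p : ℤ) ∣ a ∧ (p : ℤ) ∣ b) ∧ ¬ ((p : ℤ) ∣ a ∧ (p : ℤ) ∣ c) ∧ ¬ ((p : ℤ) ∣ b ∧ (p : ℤ) ∣ c)

theorem CoprimeAt.rotate {β a b c : ℤ} (h : CoprimeAt β a b c) : CoprimeAt β b c a :=
  fun p hp hβ => by
    obtain ⟨h1, h2, h3⟩ := h p hp hβ
    exact ⟨h3, fun h => h1 h.symm, fun h => h2 h.symm⟩

theorem CoprimeAt.shift {β a b c : ℤ} (h : CoprimeAt β a b c) (t : ℤ) :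
    CoprimeAt (β - 2 * t * (b * c)) (a + t * β - t ^ 2 * (b * c)) b c := by
  intro p hp hβ
  -- Every pair of diagonal entries contains `b` or `c`, and modulo a prime dividing `b c` and the
  -- new `β` nothing has changed.
  have key : (p : ℤ) ∣ b * c → (p : ℤ) ∣ β ∧
      ((p : ℤ) ∣ a + t * β - t ^ 2 * (b * c) → (p : ℤ) ∣ a) := fun hbc => by
    have h1 : (p : ℤ) ∣ β := (dvd_sub_left (hbc.mul_left _)).mp hβ
    exact ⟨h1, fun h2 => (dvd_add_left (h1.mul_left t)).mp ((dvd_sub_left (hbc.mul_left _)).mp h2)⟩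
  refine ⟨fun ⟨ha, hb⟩ => ?_, fun ⟨ha, hc⟩ => ?_, fun ⟨hb, hc⟩ => ?_⟩
  · obtain ⟨h1, h2⟩ := key (hb.mul_right c)
    exact (h p hp h1).1 ⟨h2 ha, hb⟩
  · obtain ⟨h1, h2⟩ := key (hc.mul_left b)
    exact (h p hp h1).2.1 ⟨h2 ha, hc⟩
  · exact (h p hp (key (hb.mul_right c)).1).2.2 ⟨hb, hc⟩

/-- Modulo `b c` the shift replaces `a` by `a + t β`, and no prime divides all of `a`, `β` and `b
c`. -/
theorem exists_shift_isCoprime {β a b c : ℤ} (h : CoprimeAt β a b c) (hbc : b * c ≠ 0) :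
    ∃ β' a' : ℤ, Equivalent (⟨1, β, diag a b c, 0⟩ : FreudenthalModule C)
      ⟨1, β', diag a' b c, 0⟩ ∧ CoprimeAt β' a' b c ∧ IsCoprime a' (b * c) := by
  obtain ⟨t, ht⟩ := Int.exists_isCoprime_add_mul (a := a) (b := β) hbc fun p hp ha hβ hm => by
    rcases (Nat.prime_iff_prime_int.mp hp).dvd_or_dvd hm with h1 | h1
    · exact (h p hp hβ).1 ⟨ha, h1⟩
    · exact (h p hp hβ).2.1 ⟨ha, h1⟩
  refine ⟨_, _, .shift t β a b c, h.shift t, ?_⟩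
  have e : a + t * β - t ^ 2 * (b * c) = (a + t * β) + -t ^ 2 * (b * c) := by ring
  rw [e]
  exact ht.add_mul_right_left _

/-- The element `(1, β, diag(a, b, c), 0)` is equivalent to one with pairwise coprime diagonal. -/
def HasCoprimeDiagonal (C : Type) [CompositionRing C] (β a b c : ℤ) : Prop :=
  ∃ β' a' b' c' : ℤ, Equivalent (⟨1, β, diag a b c, 0⟩ : FreudenthalModule C)
    ⟨1, β', diag a' b' c', 0⟩ ∧ IsCoprime a' b' ∧ IsCoprime a' c' ∧ IsCoprime b' c'

namespace HasCoprimeDiagonal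

variable {β a b c : ℤ}

theorem of_rotate (h : HasCoprimeDiagonal C β b c a) : HasCoprimeDiagonal C β a b c := by
  obtain ⟨β', a', b', c', h1, h2⟩ := h
  exact ⟨β', a', b', c', (Equivalent.rotate_diag_zero ..).trans h1, h2⟩

theorem of_ne_zero (h : CoprimeAt β a b c) (hb : b ≠ 0) (hc : c ≠ 0) :
    HasCoprimeDiagonal C β a b c := by
  obtain ⟨β', a', h1, h2, h3⟩ := exists_shift_isCoprime (C := C) h (mul_ne_zero hb hc)
  have hab : IsCoprime a' b := h3.of_mul_right_left
  have hac : IsCoprime a' c := h3.of_mul_right_right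
  by_cases ha' : a' = 0
  -- Coprimality with `0` makes `b` a unit, so `b` and `c` are coprime as well.
  · subst ha'
    rw [isCoprime_zero_left] at hab
    obtain ⟨u, hu⟩ := hab.exists_left_inv
    exact ⟨β', 0, b, c, h1, isCoprime_zero_left.mpr hab, hac, u, 0, by linarith⟩
  · obtain ⟨β'', b', h4, h5, h6⟩ := exists_shift_isCoprime (C := C) h2.rotate (mul_ne_zero hc ha')
    exact ⟨β'', b', c, a', (h1.trans (.rotate_diag_zero ..)).trans h4, h6.of_mul_right_left,
      h6.of_mul_right_right, hac.symm⟩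

theorem of_two_eq_zero (h : CoprimeAt β 0 0 c) : HasCoprimeDiagonal C β 0 0 c := by
  have hβ : β * β = 1 := by
    have h1 : β.natAbs = 1 := by
      by_contra h2
      obtain ⟨p, hp, hpβ⟩ := Nat.exists_prime_and_dvd h2
      exact (h p hp (Int.natCast_dvd.mpr hpβ)).1 ⟨dvd_zero _, dvd_zero _⟩
    have h2 := Int.natAbs_mul_self' β
    rw [← h2, h1]; rfl
  -- As `β² = 1`, shifting by `β` turns one zero into `1`; after rotation a second shift turns the
  -- other into `1 - c`, giving `diag(1 - c, c, 1)`.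
  have h1 := (Equivalent.shift (C := C) β β 0 0 c).trans (.rotate_diag_zero ..)
  have h2 := h1.trans (.shift β ..)
  have e1 : 0 + β * β - β ^ 2 * (0 * c) = 1 := by linarith
  have e2 : 0 + β * (β - 2 * β * (0 * c)) - β ^ 2 * (c * 1) = 1 - c := by
    linear_combination (1 - c) * hβ
  rw [e1, e2] at h2
  exact ⟨_, _, _, _, h2, ⟨1, 1, by ring⟩, isCoprime_one_right, isCoprime_one_right⟩

theorem of_coprimeAt (h : CoprimeAt β a b c) : HasCoprimeDiagonal C β a b c := by
  by_cases hb : b = 0 <;> by_cases hc : c = 0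
  · subst hb hc; exact of_rotate (of_two_eq_zero h.rotate)
  · by_cases ha : a = 0
    · subst ha hb; exact of_two_eq_zero h
    · exact of_rotate (of_ne_zero h.rotate hc ha)
  · by_cases ha : a = 0
    · subst ha hc; exact of_rotate (of_rotate (of_two_eq_zero h.rotate.rotate))
    · exact of_rotate (of_rotate (of_ne_zero h.rotate.rotate ha hb))
  · exact of_ne_zero h hb hc

end HasCoprimeDiagonal

theorem exists_equivalent_of_coprimeAt (hC : IsSplit C) {β a b c : ℤ} (h : CoprimeAt β a b c) :
    ∃ ε k : ℤ, (ε = 0 ∨ ε = 1) ∧ Equivalent (⟨1, β, diag a b c, 0⟩ : FreudenthalModule C)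
      ⟨1, ε, diag 1 1 k, 0⟩ := by
  obtain ⟨β', a', b', c', h1, hab, hac, hbc⟩ := HasCoprimeDiagonal.of_coprimeAt (C := C) h
  have h2 := h1.trans (.of_normEquivalent (.diag_of_pairwise hC hab hac hbc) _ _)
  -- With the other two entries equal to `1`, the shift subtracts `2 (β' / 2)` and leaves the parity
  -- of `β'`.
  have h3 := (h2.trans (.shift (β' / 2) ..)).trans (.rotate_diag_zero ..)
  refine ⟨_, _, ?_, h3⟩
  omega

theorem Projective.exists_coprimeAt {x : FreudenthalModule C} (h : x.Projective) :
    ∃ β a b c : ℤ, CoprimeAt β a b c ∧ Equivalent x ⟨1, β, diag a b c, 0⟩ := by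
  obtain ⟨α, β, a₁, a₂, a₃, hα, hβ, h1, h2, h3, hx, p1, p2, p3⟩ := h
  simp only [PrimitiveForm, mul_zero, sub_zero, neg_zero, zero_add, zero_sub] at p1 p2 p3
  have hdvd : ∀ {u v w d : ℤ}, Int.gcd u (Int.gcd v w) = 1 → d ∣ u → d ∣ v → d ∣ w → d ∣ 1 :=
      fun {u v w d} hg hu hv hw => by
    have := Int.dvd_coe_gcd hu (Int.dvd_coe_gcd hv hw)
    rwa [hg] at this
  -- All three coefficients of a primitive form are divisible by `α`.
  have hα1 : α = 1 := by
    have := hdvd p1 (dvd_mul_right α a₁) ((dvd_mul_right α β).neg_right)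
      ((h2.mul_right a₃).neg_right)
    exact Int.eq_one_of_dvd_one hα.le this
  subst hα1
  refine ⟨β, a₁, a₂, a₃, fun p hp hpβ => ?_, hx⟩
  have hp1 : ¬ (p : ℤ) ∣ 1 := (Nat.prime_iff_prime_int.mp hp).not_dvd_one
  have hpβ' : (p : ℤ) ∣ -(1 * β) := by simpa using hpβ
  simp only [one_mul] at p1 p2 p3 hpβ'
  exact ⟨fun ⟨ha, hb⟩ => hp1 (hdvd p1 ha hpβ' (hb.mul_right _).neg_right),
    fun ⟨ha, hc⟩ => hp1 (hdvd p1 ha hpβ' (hc.mul_left _).neg_right),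
    fun ⟨hb, hc⟩ => hp1 (hdvd p2 hb hpβ' (hc.mul_right _).neg_right)⟩

theorem quartic'_normal (ε k : ℤ) :
    quartic' (⟨1, ε, diag 1 1 k, 0⟩ : FreudenthalModule C) = ε ^ 2 + 4 * k := by
  simp [quartic', sharp_zero, bil_zero_right, det_diag, det_zero]
  ring

theorem normal_unique {ε k ε' k' : ℤ} (hε : ε = 0 ∨ ε = 1) (hε' : ε' = 0 ∨ ε' = 1)
    (h : ε ^ 2 + 4 * k = ε' ^ 2 + 4 * k') : ε = ε' ∧ k = k' := by
  rcases hε with rfl | rfl <;> rcases hε' with rfl | rfl <;> omega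

theorem Projective.exists_normal (hC : IsSplit C) {x : FreudenthalModule C} (h : x.Projective) :
    ∃ ε k : ℤ, (ε = 0 ∨ ε = 1) ∧ x.quartic' = ε ^ 2 + 4 * k ∧
      x.Equivalent ⟨1, ε, diag 1 1 k, 0⟩ := by
  obtain ⟨β, a, b, c, h1, h2⟩ := h.exists_coprimeAt
  obtain ⟨ε, k, hε, h3⟩ := exists_equivalent_of_coprimeAt hC h1
  have h4 := h2.trans h3
  exact ⟨ε, k, hε, by rw [← h4.quartic'_eq, quartic'_normal], h4⟩

end FreudenthalModule

/-! ### The classification. -/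

theorem theorem4 (κ : SplitKind) :
    -- rank one
    (∀ x : FreudenthalModule (SplitRing κ), x.rank = 1 →
      1 ≤ x.d₁ ∧ x.Equivalent ⟨x.d₁, 0, 0, 0⟩) ∧
    (∀ k : ℤ, 1 ≤ k → (⟨k, 0, 0, 0⟩ : FreudenthalModule (SplitRing κ)).rank = 1) ∧
    (∀ k k' : ℤ, 1 ≤ k → 1 ≤ k' →
      (⟨k, 0, 0, 0⟩ : FreudenthalModule (SplitRing κ)).Equivalent ⟨k', 0, 0, 0⟩ → k = k') ∧
    -- rank two
    (∀ x : FreudenthalModule (SplitRing κ), x.rank = 2 →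
      ∃ a : ℤ, 0 < x.d₁ ∧ 0 < a ∧ x.d₁ ∣ a ∧ 2 * x.d₁ * a = x.d₂ ∧
        x.Equivalent ⟨x.d₁, 0, Herm3.diag a 0 0, 0⟩) ∧
    (∀ k m : ℤ, 0 < k → 0 < m → k ∣ m →
      (⟨k, 0, Herm3.diag m 0 0, 0⟩ : FreudenthalModule (SplitRing κ)).rank = 2) ∧
    (∀ k m k' m' : ℤ, 0 < k → 0 < m → k ∣ m → 0 < k' → 0 < m' → k' ∣ m' →
      (⟨k, 0, Herm3.diag m 0 0, 0⟩ : FreudenthalModule (SplitRing κ)).Equivalent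
        ⟨k', 0, Herm3.diag m' 0 0, 0⟩ → k = k' ∧ m = m') ∧
    -- projective elements of rank three or four
    (∀ x y : FreudenthalModule (SplitRing κ), (x.rank = 3 ∨ x.rank = 4) →
      (y.rank = 3 ∨ y.rank = 4) → x.Projective → y.Projective → x.quartic' = y.quartic' →
      x.Equivalent y) ∧
    (∀ x : FreudenthalModule (SplitRing κ), (x.rank = 3 ∨ x.rank = 4) → x.Projective →
      ∃ ε k : ℤ, (ε = 0 ∨ ε = 1) ∧ ε ≡ x.quartic' [ZMOD 2] ∧ 4 * k = x.quartic' - ε ^ 2 ∧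
        x.Equivalent ⟨1, ε, Herm3.diag 1 1 k, 0⟩ ∧
        ∀ ε' k' : ℤ, (ε' = 0 ∨ ε' = 1) →
          x.Equivalent ⟨1, ε', Herm3.diag 1 1 k', 0⟩ → ε' = ε ∧ k' = k) := by
  have hC := CompositionRing.isSplit_splitRing κ
  refine ⟨fun x hx => FreudenthalModule.exists_rank_one hC hx,
    fun k hk => FreudenthalModule.rank_eq_one hk, fun k k' hk hk' h => ?_,
    fun x hx => FreudenthalModule.exists_rank_two hC hx,
    fun k m hk hm _ => FreudenthalModule.rank_eq_two hk hm,
    fun k m k' m' hk hm hkm hk' hm' hkm' h => ?_, fun x y _ _ hx hy hq => ?_, fun x _ hx => ?_⟩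
  · have := h.d₁_eq
    rwa [FreudenthalModule.d₁_rank_one hk, FreudenthalModule.d₁_rank_one hk', eq_comm] at this
  · have h1 := h.d₁_eq
    rw [FreudenthalModule.d₁_rank_two hk hkm, FreudenthalModule.d₁_rank_two hk' hkm'] at h1
    have h2 := h.d₂_eq
    rw [FreudenthalModule.d₂_rank_two hk hm, FreudenthalModule.d₂_rank_two hk' hm', h1] at h2
    exact ⟨h1.symm, (mul_left_cancel₀ (by positivity) h2).symm⟩
  · obtain ⟨ε, k, hε, hxq, hx⟩ := hx.exists_normal hC
    obtain ⟨ε', k', hε', hyq, hy⟩ := hy.exists_normal hC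
    obtain ⟨rfl, rfl⟩ := FreudenthalModule.normal_unique hε hε' (by rw [← hxq, hq, hyq])
    exact hx.trans hy.symm
  · obtain ⟨ε, k, hε, hxq, hx⟩ := hx.exists_normal hC
    refine ⟨ε, k, hε, ?_, by linarith, hx, fun ε' k' hε' h => ?_⟩
    · rw [hxq]
      simp only [Int.ModEq]
      rcases hε with rfl | rfl <;> omega
    · refine FreudenthalModule.normal_unique hε' hε ?_
      rw [← hxq, ← h.quartic'_eq, FreudenthalModule.quartic'_normal]
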